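/- Let $d,L\ge 1$ be integers and let $\beta_1,\dots,\beta_L\in\mathbb R$ be distinct and not all zero. Then there exist an integer $\alpha_d\in\{1,\dots,L\}$ and real coefficients $C_\ell^{(p)}$ ($1\le \ell\le L$, $1\le p\le d$), depending only on $d$ and $\beta_1,\dots,\beta_L$, for which the following holds; moreover $\alpha_d=L$ can be taken if the numbers $|\beta_\ell|$ are nonzero and pairwise distinct. *Setting.* Let $X'_1,\dots,X'_d,V_1,\dots,V_d$ be independent real random variables. Each $X'_j$ has a distribution function $G_j$ and a probability density $g_j$ that is positive almost everywhere on an open interval $I_j$ (bounded or not) and zero almost everywhere outside $I_j$; put $\Omega=I_1\times\dots\times I_d$. The $V_j$ satisfy $E[V_j]=0$, $E[V_j^2]=\sigma^2>0$, $E[V_j^{2q+1}]=0$ and $E[V_j^{2q}]<\infty$ for all integers $q\ge 1$. For $x\in\Omega$ and $h\in(0,\infty)^d$ put $$E_k=\frac{G_k(X'_k)-\mathbf 1_{[X'_k\ge x_k]}}{g_k(X'_k)},\qquad R_k=\frac{E_k\,V_k}{h_k\,\sigma^2},\qquad R(x,X',V)=(R_1,\dots,R_d),$$ let $e_p(r)=\sum_{|w|=p}\prod_{k\in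 w}r_k$ be the $p$-th elementary symmetric polynomial in $d$ variables, and write $\beta_\ell hV=(\beta_\ell h_1V_1,\dots,\beta_\ell h_dV_d)$. *Smoothness.* Let $x\in\Omega$ and $1\le\alpha\le\alpha_d$, put $N=d+2\alpha$, and let $M:\mathbb R^d\to\mathbb R$ be of class $C^{N}$. Assume that there are $\varepsilon>0$ and a random variable $\Phi$ such that, almost surely, all derivatives of $M$ of order at most $N$ at the points $X'+t$ with $|t_k|\le\varepsilon|V_k|$ ($1\le k\le d$) are bounded in norm by $\Phi$, and such that $E\big[\Phi\,(1+\|V\|)^{d+N}\prod_{k\in w}|E_k|\big]<\infty$ for every $w\subseteq\{1,\dots,d\}$. (For instance, this holds if the derivatives of $M$ up to order $N$ have polynomial growth and the $X'_j$ have finite moments of all orders.) *Conclusion.* The variable $M(X')$ is integrable; for all sufficiently small $h\in(0,\infty)^d$ the variables $M(X'+\beta_\ell hV)\,e_p(R(x,X',V))$ are integrable; and $M^c(x)=M(x)-E[M(X')]$ satisfies $$M^c(x)=\sum_{\ell=1}^{L}\sum_{p=1}^{d}C_\ell^{(p)}\,E\big[M(X'+\beta_\ell hV)\,e_p(R(x,X',V))\big]+O\big(\|h\|^{2\alpha}\big)\qquad(h\to0,\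 h\in(0,\infty)^d).$$ In particular the error is $O(\|h\|^{2\alpha_d})$ when the smoothness assumption holds with $\alpha=\alpha_d$. -/

import Mathlib

open MeasureTheory ProbabilityTheory Filter Topology Asymptotics

/-- The vector `X'` has continuous coordinates `X' j` with probability density functions `g j`,
and it is supported on the open domain `Ω = ∏ j, I j`: each `I j` is an open interval, bounded or
not, and up to Lebesgue-null sets `g j` is positive exactly on `I j`. (The support of a vector of
independent coordinates is a product, and a connected open product is a product of open
intervals.) -/
structure ContinuousInputs {d : ℕ} {S : Type*} [MeasurableSpace S] (P : Measure S)
    (I : Fin d → Set ℝ) (g : Fin d → ℝ → ℝ) (X : Fin d → S → ℝ) : Prop where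
  isOpen_interval : ∀ j, IsOpen (I j)
  ordConnected_interval : ∀ j, (I j).OrdConnected
  measurable_density : ∀ j, Measurable (g j)
  density_nonneg : ∀ j t, 0 ≤ g j t
  density_pos_iff : ∀ j, ∀ᵐ t, 0 < g j t ↔ t ∈ I j
  measurable_input : ∀ j, Measurable (X j)
  map_input : ∀ j, P.map (X j) = volume.withDensity (fun t => ENNReal.ofReal (g j t))

/-- The coordinates of `V` are centered with variance `σ ^ 2`, their odd moments vanish and their
even moments are finite. -/
structure Perturbation {d : ℕ} {S : Type*} [MeasurableSpace S] (P : Measure S)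
    (σ : ℝ) (V : Fin d → S → ℝ) : Prop where
  measurable_coord : ∀ j, Measurable (V j)
  integrable_even : ∀ j (q : ℕ), Integrable (fun ω => V j ω ^ (2 * q)) P
  mean_zero : ∀ j, ∫ ω, V j ω ∂P = 0
  second_moment : ∀ j, ∫ ω, V j ω ^ 2 ∂P = σ ^ 2
  odd_moment : ∀ j (q : ℕ), 0 < q → ∫ ω, V j ω ^ (2 * q + 1) ∂P = 0

/-- The ratio `(G(t) - 1[t ≥ x]) / g(t)`, where `G` is the distribution function of `μ`. -/
noncomputable def anovaRatio (μ : Measure ℝ) (g : ℝ → ℝ) (x t : ℝ) : ℝ :=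
  (cdf μ t - (Set.Ici x).indicator 1 t) / g t

/-- The random weights `R_k(x_k, X'_k, V_k)`. -/
noncomputable def randomWeight {d : ℕ} {S : Type*} [MeasurableSpace S] (P : Measure S)
    (g : Fin d → ℝ → ℝ) (X V : Fin d → S → ℝ) (σ : ℝ) (h x : Fin d → ℝ) (ω : S) (k : Fin d) : ℝ :=
  anovaRatio (P.map (X k)) (g k) (x k) (X k ω) / (h k * σ ^ 2) * V k ω

/-- The random variable `M(X' + β h V) e_p(R(x, X', V))`, with `e_p` the `p`-th elementary
symmetric polynomial. -/
noncomputable def surrogateTerm {d : ℕ} {S : Type*} [MeasurableSpace S] (P : Measure S)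
    (g : Fin d → ℝ → ℝ) (X V : Fin d → S → ℝ) (σ : ℝ) (M : (Fin d → ℝ) → ℝ)
    (h x : Fin d → ℝ) (β : ℝ) (p : ℕ) (ω : S) : ℝ :=
  M (fun k => X k ω + β * h k * V k ω) *
    MvPolynomial.eval (randomWeight P g X V σ h x ω) (MvPolynomial.esymm (Fin d) ℝ p)

/-- `M` is smooth of order `N` relative to the laws of `X'` and `V`: it is of class `C ^ N` on
`ℝ ^ d`, and its derivatives of order at most `N` in a box of half-widths `ε |V k|` around `X'` are
dominated by a random variable `Φ` for which the expectations of
`Φ (1 + ‖V‖) ^ (d + N) ∏_{k ∈ w} |G_k(X'_k) - 1[X'_k ≥ x_k]| / g_k(X'_k)` are finite.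
(Only the finiteness matters, so the choice of the norm on `ℝ ^ d` is immaterial.) -/
structure SmoothEnough {d : ℕ} {S : Type*} [MeasurableSpace S] (P : Measure S)
    (g : Fin d → ℝ → ℝ) (X V : Fin d → S → ℝ) (x : Fin d → ℝ) (N : ℕ)
    (M : (Fin d → ℝ) → ℝ) : Prop where
  contDiff : ContDiff ℝ N M
  dominated : ∃ ε : ℝ, 0 < ε ∧ ∃ Φ : S → ℝ,
    (∀ᵐ ω ∂P, ∀ t : Fin d → ℝ, (∀ k, |t k| ≤ ε * |V k ω|) → ∀ n ≤ N,
      ‖iteratedFDeriv ℝ n M (fun k => X k ω + t k)‖ ≤ Φ ω) ∧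
    ∀ w : Finset (Fin d), Integrable (fun ω => Φ ω * (1 + ‖fun k => V k ω‖) ^ (d + N) *
      ∏ k ∈ w, |anovaRatio (P.map (X k)) (g k) (x k) (X k ω)|) P

/-!
The proof has two halves that meet in the means `E[∂_w M(X') ∏_{k ∈ w} E_k]`, where
`E_k = (G_k(X'_k) - 1[X'_k ≥ x_k]) / g_k(X'_k)` and `∂_w` differentiates once in each coordinate
of `w`.

In one variable, Fubini's theorem for the kernel `f'(t) (1[s ≤ t] - 1[x ≤ t])` gives
`f(x) = E f(Y) + E[f'(Y) (G(Y) - 1[Y ≥ x]) / g(Y)]`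
(`eq_integral_add_integral_deriv_mul_anovaRatio`). Freezing the coordinates of `X'` at `x` one at a
time turns this into `M(x) = ∑_w E[∂_w M(X') ∏_{k ∈ w} E_k]`
(`integral_piecewise_eq_sum_mixedPartial`); the empty set contributes `E[M(X')]`.

For the surrogates, `e_p` is a sum over the sets `w` with `p` elements, and for each of them
`E[M(X' + β h V) ∏_{k ∈ w} E_k V_k]` is to be expanded. A plain Taylor expansion of `M` leaves a
remainder of size `‖h‖ ^ (p + 2 α)`, which division by `∏_{k ∈ w} h_k` would spoil when the `h_k`
are not comparable. Since `V` is centred and has independent coordinates, `M` may instead be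
replaced by its mixed difference over `w`, which is `∏_{k ∈ w} β h_k V_k` times an average of
`∂_w M` (`exists_average_mixedPartial`). Taylor's formula is then applied to `∂_w M` to order
`2 α`, so that the product of the `h_k` cancels exactly (`exists_mixedDifference_taylor`). The terms
of odd degree vanish because the odd moments of `V` do, so the outcome, divided by `∏ h_k σ ^ 2`, is
`β ^ p (E[∂_w M(X') ∏ E_k] + β ^ 2 A_1(h) + ⋯ + β ^ (2 α - 2) A_{α - 1}(h)) + O(‖h‖ ^ (2 α))`
with `A_s` independent of `β` (`exists_expansion_integral_mul_prod`). Coefficients with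
`∑_ℓ C_ℓ β_ℓ ^ (p + 2 s) = δ_{s 0}` for `s < α` (`exists_moment_coefficients`) leave only the leading
term.
-/

/-! ### Mixed partial derivatives -/

/-- The partial derivative `∂_k F`. -/
noncomputable def partialDeriv {d : ℕ} (k : Fin d) (F : (Fin d → ℝ) → ℝ) : (Fin d → ℝ) → ℝ :=
  fun y => fderiv ℝ F y (Pi.single k 1)

/-- The iterated partial derivative along a list of coordinates; the head of the list is
differentiated first. -/
noncomputable def iterPartial {d : ℕ} : List (Fin d) → ((Fin d → ℝ) → ℝ) → (Fin d → ℝ) → ℝ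
  | [], F => F
  | k :: l, F => iterPartial l (partialDeriv k F)

/-- The mixed partial derivative `∂_w F`, of order one in each coordinate of `w`. The coordinates
are differentiated in increasing order, so that no symmetry of second derivatives is needed. -/
noncomputable def mixedPartial {d : ℕ} (w : Finset (Fin d)) (F : (Fin d → ℝ) → ℝ) :
    (Fin d → ℝ) → ℝ :=
  iterPartial (w.sort (· ≤ ·)) F

section
variable {d : ℕ} {F : (Fin d → ℝ) → ℝ}

lemma mixedPartial_empty : mixedPartial ∅ F = F := by
  simp [mixedPartial, iterPartial]

lemma mixedPartial_insert {k : Fin d} {w : Finset (Fin d)} (hk : ∀ j ∈ w, k < j) :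
    mixedPartial (insert k w) F = mixedPartial w (partialDeriv k F) := by
  unfold mixedPartial
  rw [Finset.sort_insert _ (fun b hb => (hk b hb).le) (fun h => (hk k h).false)]
  rfl

lemma ContDiff.partialDeriv {n : ℕ} (hF : ContDiff ℝ (n + 1 : ℕ) F) (k : Fin d) :
    ContDiff ℝ n (partialDeriv k F) := by
  have h : ContDiff ℝ n (fderiv ℝ F) := hF.fderiv_right (by norm_cast)
  exact h.clm_apply contDiff_const

lemma ContDiff.mixedPartial {n : ℕ} (w : Finset (Fin d)) (hF : ContDiff ℝ (n + w.card : ℕ) F) :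
    ContDiff ℝ n (mixedPartial w F) := by
  induction w using Finset.induction_on_min generalizing F with
  | empty => simpa [mixedPartial_empty] using hF
  | insert k w hk ih =>
    rw [mixedPartial_insert hk]
    rw [Finset.card_insert_of_notMem fun h => (hk k h).false] at hF
    exact ih (ContDiff.partialDeriv hF k)

lemma norm_iteratedFDeriv_partialDeriv_le {n : ℕ} (hF : ContDiff ℝ (n + 1 : ℕ) F) (k : Fin d)
    (y : Fin d → ℝ) :
    ‖iteratedFDeriv ℝ n (partialDeriv k F) y‖ ≤ ‖iteratedFDeriv ℝ (n + 1) F y‖ := by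
  have h : ContDiff ℝ n (fderiv ℝ F) := hF.fderiv_right (by norm_cast)
  refine (norm_iteratedFDeriv_clm_apply_const h.contDiffAt le_rfl).trans ?_
  rw [norm_iteratedFDeriv_fderiv, Pi.norm_single, norm_one, one_mul]

lemma norm_iteratedFDeriv_mixedPartial_le {n : ℕ} (w : Finset (Fin d))
    (hF : ContDiff ℝ (n + w.card : ℕ) F) (y : Fin d → ℝ) :
    ‖iteratedFDeriv ℝ n (mixedPartial w F) y‖ ≤ ‖iteratedFDeriv ℝ (n + w.card) F y‖ := by
  induction w using Finset.induction_on_min generalizing F with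
  | empty =>
    rw [mixedPartial_empty]
    exact le_refl _
  | insert k w hk ih =>
    rw [mixedPartial_insert hk]
    have hc : (insert k w).card = w.card + 1 :=
      Finset.card_insert_of_notMem fun h => (hk k h).false
    rw [hc] at hF ⊢
    exact (ih (ContDiff.partialDeriv hF k)).trans (norm_iteratedFDeriv_partialDeriv_le hF k y)

/-- The derivative of `F` along the `k`-th coordinate line. -/
lemma hasDerivAt_comp_update {n : ℕ} (hF : ContDiff ℝ (n + 1 : ℕ) F) (k : Fin d) (y : Fin d → ℝ)
    (τ : ℝ) :
    HasDerivAt (fun τ => F (Function.update y k τ)) (partialDeriv k F (Function.update y k τ)) τ := by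
  have h1 : HasFDerivAt F (fderiv ℝ F (Function.update y k τ)) (Function.update y k τ) :=
    (hF.differentiable (by norm_cast)).differentiableAt.hasFDerivAt
  exact h1.comp_hasDerivAt τ (hasDerivAt_update y k τ)

/-! ### Mixed differences as averaged mixed derivatives -/

lemma integrable_of_ae_mem_Icc {ν : Measure (Fin d → ℝ)} [IsFiniteMeasure ν]
    (hν : ∀ᵐ s ∂ν, s ∈ Set.Icc (0 : Fin d → ℝ) 1) {G : (Fin d → ℝ) → ℝ} (hG : Continuous G) :
    Integrable G ν := by
  obtain ⟨C, hC⟩ := (isCompact_Icc (a := (0 : Fin d → ℝ)) (b := 1)).exists_bound_of_continuousOn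
    hG.continuousOn
  refine Integrable.of_bound hG.aestronglyMeasurable C ?_
  filter_upwards [hν] with s hs using hC s hs

/-- The alternating sum of the values of `F` obtained by switching off increments in the
coordinates of `w` is the product of these increments times an average of `∂_w F`. The averaging
measure on the cube does not depend on `F`. -/
lemma exists_average_mixedPartial (w : Finset (Fin d)) :
    ∃ ν : Measure (Fin d → ℝ), IsProbabilityMeasure ν ∧
      (∀ᵐ s ∂ν, s ∈ Set.Icc (0 : Fin d → ℝ) 1) ∧
      ∀ F : (Fin d → ℝ) → ℝ, ContDiff ℝ w.card F → ∀ y t : Fin d → ℝ,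
        ∑ v ∈ w.powerset, (-1) ^ v.card * F (y + v.piecewise 0 t) =
          (∏ k ∈ w, t k) * ∫ s, mixedPartial w F (y + s * t) ∂ν := by
  induction w using Finset.induction_on_min with
  | empty =>
    refine ⟨Measure.dirac 1, inferInstance, ?_, fun F _ y t => ?_⟩
    · rw [ae_dirac_eq]
      simp
    · simp [mixedPartial_empty]
  | insert k w hk ih =>
    obtain ⟨ν, hνp, hν, hνF⟩ := ih
    have hkw : k ∉ w := fun h => (hk k h).false
    let μ : Measure ℝ := volume.restrict (Set.Icc 0 1)
    have hμp : IsProbabilityMeasure μ := ⟨by simp [μ]⟩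
    -- the new averaging measure rescales the `k`-th coordinate by an independent uniform variable
    let φ : ℝ × (Fin d → ℝ) → Fin d → ℝ := fun p => Function.update p.2 k (p.1 * p.2 k)
    have hφc : Continuous φ := by
      refine continuous_snd.update k ?_
      fun_prop
    have hφm : Measurable φ := hφc.measurable
    have hμ : ∀ᵐ τ ∂μ, τ ∈ Set.Icc (0 : ℝ) 1 := ae_restrict_mem measurableSet_Icc
    have hcube : ∀ᵐ s ∂(μ.prod ν).map φ, s ∈ Set.Icc (0 : Fin d → ℝ) 1 := by
      refine (ae_map_iff hφm.aemeasurable measurableSet_Icc).2 ?_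
      filter_upwards [Measure.quasiMeasurePreserving_fst.ae hμ,
        Measure.quasiMeasurePreserving_snd.ae hν] with p h1 h2
      refine ⟨fun j => ?_, fun j => ?_⟩ <;> by_cases hj : j = k
      · subst hj
        simpa [φ] using mul_nonneg h1.1 (h2.1 j)
      · simpa [φ, hj] using h2.1 j
      · subst hj
        simpa [φ] using mul_le_one₀ h1.2 (h2.1 j) (h2.2 j)
      · simpa [φ, hj] using h2.2 j
    have hprob : IsProbabilityMeasure ((μ.prod ν).map φ) :=
      Measure.isProbabilityMeasure_map hφm.aemeasurable
    refine ⟨(μ.prod ν).map φ, hprob, hcube, fun F hF y t => ?_⟩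
    have hc : (insert k w).card = w.card + 1 := Finset.card_insert_of_notMem hkw
    rw [hc] at hF
    have hF' : ContDiff ℝ w.card (partialDeriv k F) := ContDiff.partialDeriv hF k
    have hG : Continuous (mixedPartial w (partialDeriv k F)) :=
      (ContDiff.mixedPartial (n := 0) w (by simpa using hF')).continuous
    -- the increments with the `k`-th one scaled by `τ`
    let T : ℝ → Fin d → ℝ := fun τ => Function.update t k (τ * t k)
    have hstep : ∀ v ∈ w.powerset,
        F (y + v.piecewise 0 t) - F (y + (insert k v).piecewise 0 t) =
          ∫ τ in (0 : ℝ)..1, t k * partialDeriv k F (y + v.piecewise 0 (T τ)) := by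
      intro v hv
      have hkv : k ∉ v := fun h => hkw (Finset.mem_powerset.1 hv h)
      have hupd : ∀ τ, y + v.piecewise 0 (T τ) =
          Function.update (y + v.piecewise 0 t) k (y k + τ * t k) := by
        intro τ
        funext j
        by_cases hj : j = k
        · subst hj
          simp [T, hkv]
        · by_cases hjv : j ∈ v <;> simp [T, hj, hjv]
      have hder : ∀ τ : ℝ, HasDerivAt (fun τ => F (y + v.piecewise 0 (T τ)))
          (t k * partialDeriv k F (y + v.piecewise 0 (T τ))) τ := by
        intro τ
        simp only [hupd]
        have h1 := hasDerivAt_comp_update hF k (y + v.piecewise 0 t) (y k + τ * t k)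
        have h2 : HasDerivAt (fun τ : ℝ => y k + τ * t k) (t k) τ := by
          simpa using ((hasDerivAt_id τ).mul_const (t k)).const_add (y k)
        simpa [mul_comm, Function.comp_def] using h1.comp τ h2
      have hcont : Continuous fun τ : ℝ =>
          t k * partialDeriv k F (y + v.piecewise 0 (T τ)) := by
        simp only [hupd]
        have h3 : Continuous fun τ : ℝ =>
            Function.update (y + v.piecewise 0 t) k (y k + τ * t k) :=
          continuous_const.update k (by fun_prop)
        exact continuous_const.mul (hF'.continuous.comp h3)
      rw [intervalIntegral.integral_eq_sub_of_hasDerivAt (fun τ _ => hder τ)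
        (hcont.intervalIntegrable _ _)]
      congr 2
      · congr 1
        funext j
        by_cases hjv : j ∈ v <;> simp [T, hjv]
      · congr 1
        funext j
        by_cases hj : j = k
        · subst hj
          simp [T, hkv]
        · by_cases hjv : j ∈ v <;> simp [T, hj, hjv]
    have hint : ∀ v ∈ w.powerset, IntervalIntegrable (fun τ =>
        (-1) ^ v.card * (t k * partialDeriv k F (y + v.piecewise 0 (T τ)))) volume 0 1 := by
      intro v _
      refine Continuous.intervalIntegrable ?_ _ _
      have hT : Continuous T := continuous_const.update k (by fun_prop)
      have h3 : Continuous fun τ : ℝ => y + v.piecewise 0 (T τ) := by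
        refine continuous_const.add (continuous_pi fun j => ?_)
        by_cases hjv : j ∈ v
        · simp [hjv, continuous_const]
        · simpa [hjv, Function.comp_def] using (continuous_apply j).comp hT
      exact continuous_const.mul (continuous_const.mul (hF'.continuous.comp h3))
    have hscale : ∀ τ s, y + s * T τ = y + φ (τ, s) * t := by
      intro τ s
      funext j
      by_cases hj : j = k
      · subst hj
        simp [T, φ]
        ring
      · simp [T, φ, hj]
    have hTw : ∀ τ, ∏ j ∈ w, T τ j = ∏ j ∈ w, t j := fun τ =>
      Finset.prod_congr rfl fun j hj => by
        have : j ≠ k := fun h => hkw (h ▸ hj)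
        simp [T, this]
    have hGc : Continuous fun s => mixedPartial w (partialDeriv k F) (y + s * t) := by fun_prop
    have hprodint : Integrable
        (fun p => mixedPartial w (partialDeriv k F) (y + φ p * t)) (μ.prod ν) :=
      (integrable_map_measure hGc.aestronglyMeasurable hφm.aemeasurable).1
        (integrable_of_ae_mem_Icc hcube hGc)
    calc ∑ v ∈ (insert k w).powerset, (-1) ^ v.card * F (y + v.piecewise 0 t)
        = ∑ v ∈ w.powerset, (-1) ^ v.card *
            (F (y + v.piecewise 0 t) - F (y + (insert k v).piecewise 0 t)) := by
          rw [Finset.sum_powerset_insert hkw, ← Finset.sum_add_distrib]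
          refine Finset.sum_congr rfl fun v hv => ?_
          rw [Finset.card_insert_of_notMem fun h => hkw (Finset.mem_powerset.1 hv h)]
          ring
      _ = ∫ τ in (0 : ℝ)..1, ∑ v ∈ w.powerset,
            (-1) ^ v.card * (t k * partialDeriv k F (y + v.piecewise 0 (T τ))) := by
          rw [intervalIntegral.integral_finsetSum hint]
          refine Finset.sum_congr rfl fun v hv => ?_
          rw [hstep v hv, ← intervalIntegral.integral_const_mul]
      _ = ∫ τ in (0 : ℝ)..1, (t k * ∏ j ∈ w, t j) *
            ∫ s, mixedPartial w (partialDeriv k F) (y + φ (τ, s) * t) ∂ν := by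
          refine intervalIntegral.integral_congr fun τ _ => ?_
          have := hνF _ hF' y (T τ)
          simp only [hscale, hTw] at this
          rw [mul_assoc, ← this, Finset.mul_sum]
          exact Finset.sum_congr rfl fun v _ => by ring
      _ = (∏ j ∈ insert k w, t j) *
            ∫ s, mixedPartial (insert k w) F (y + s * t) ∂(μ.prod ν).map φ := by
          rw [intervalIntegral.integral_const_mul, Finset.prod_insert hkw, mixedPartial_insert hk,
            integral_map hφm.aemeasurable hGc.aestronglyMeasurable,
            integral_prod _ hprodint, intervalIntegral.integral_of_le zero_le_one,
            ← integral_Icc_eq_integral_Ioc]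

/-! ### Taylor expansion -/

/-- Taylor's formula in monomial form, with a bound on the remainder: the `j`-th homogeneous part
is expanded over all words of length `j` in the coordinates. -/
lemma abs_sub_taylor_le {n : ℕ} (hn : 0 < n) (hF : ContDiff ℝ n F) (y q : Fin d → ℝ) {B : ℝ}
    (hB : ∀ τ ∈ Set.Icc (0 : ℝ) 1, ‖iteratedFDeriv ℝ n F (y + τ • q)‖ ≤ B) :
    |F (y + q) - ∑ j ∈ Finset.range n, ∑ r : Fin j → Fin d,
        (∏ i, q (r i)) * ((j.factorial : ℝ)⁻¹ *
          iteratedFDeriv ℝ j F y (fun i => Pi.single (r i) 1))| ≤ B * ‖q‖ ^ n := by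
  obtain ⟨m, rfl⟩ : ∃ m, n = m + 1 := ⟨n - 1, by omega⟩
  have hB0 : 0 ≤ B := (norm_nonneg _).trans (hB 0 (by simp))
  have hT := map_add_eq_sum_add_integral_iteratedFDeriv (f := F) (x := y) (y := q) (n := m)
    (fun t _ => by exact_mod_cast hF.contDiffAt)
  have hexp : ∀ j, (j.factorial : ℝ)⁻¹ • iteratedFDeriv ℝ j F y (fun _ => q) =
      ∑ r : Fin j → Fin d, (∏ i, q (r i)) * ((j.factorial : ℝ)⁻¹ *
          iteratedFDeriv ℝ j F y (fun i => Pi.single (r i) 1)) := by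
    intro j
    have hq : (fun _ : Fin j => q) = fun _ : Fin j => ∑ k, q k • (Pi.single k 1 : Fin d → ℝ) := by
      funext i
      exact pi_eq_sum_univ' q
    rw [hq, ContinuousMultilinearMap.map_sum, smul_eq_mul, Finset.mul_sum]
    refine Finset.sum_congr rfl fun r _ => ?_
    rw [ContinuousMultilinearMap.map_smul_univ, smul_eq_mul]
    ring
  rw [hT, Finset.sum_congr rfl fun j _ => hexp j, add_sub_cancel_left, ← Real.norm_eq_abs,
    norm_smul]
  have h1 : ‖(m.factorial : ℝ)⁻¹‖ ≤ 1 := by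
    rw [norm_inv, Real.norm_natCast]
    exact inv_le_one_of_one_le₀ (by exact_mod_cast Nat.one_le_iff_ne_zero.2 m.factorial_ne_zero)
  have h2 : ‖∫ t in (0 : ℝ)..1, (1 - t) ^ m • iteratedFDeriv ℝ (m + 1) F (y + t • q)
      (fun _ => q)‖ ≤ (B * ‖q‖ ^ (m + 1)) * |1 - 0| := by
    refine intervalIntegral.norm_integral_le_of_norm_le_const fun t ht => ?_
    rw [Set.uIoc_of_le zero_le_one] at ht
    rw [norm_smul]
    have h3 : ‖(1 - t) ^ m‖ ≤ 1 := by
      rw [norm_pow]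
      refine pow_le_one₀ (norm_nonneg _) ?_
      rw [Real.norm_eq_abs, abs_le]
      constructor <;> linarith [ht.1, ht.2]
    have h4 : ‖iteratedFDeriv ℝ (m + 1) F (y + t • q) (fun _ => q)‖ ≤ B * ‖q‖ ^ (m + 1) := by
      refine (ContinuousMultilinearMap.le_opNorm _ _).trans ?_
      rw [Finset.prod_const, Finset.card_univ, Fintype.card_fin]
      exact mul_le_mul_of_nonneg_right (hB t ⟨ht.1.le, ht.2⟩) (by positivity)
    calc _ ≤ 1 * (B * ‖q‖ ^ (m + 1)) := mul_le_mul h3 h4 (norm_nonneg _) zero_le_one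
      _ = _ := one_mul _
  calc _ ≤ 1 * ((B * ‖q‖ ^ (m + 1)) * |1 - 0|) := mul_le_mul h1 h2 (norm_nonneg _) zero_le_one
    _ = _ := by simp
end

/-! ### Resampling one coordinate of a product measure -/

section
variable {ι : Type*} [Fintype ι] [DecidableEq ι] (μ : ι → Measure ℝ)
  [∀ i, IsProbabilityMeasure (μ i)]

/-- Replacing one coordinate of a sample of a product measure by an independent copy does not
change the law. -/
lemma measurePreserving_update_pi (k : ι) :
    MeasurePreserving (fun p : ℝ × (ι → ℝ) => Function.update p.2 k p.1)
      ((μ k).prod (Measure.pi μ)) (Measure.pi μ) := by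
  have hm : Measurable (fun p : ℝ × (ι → ℝ) => Function.update p.2 k p.1) := by
    refine measurable_pi_lambda _ fun i => ?_
    by_cases hi : i = k
    · subst hi
      simpa using measurable_fst
    · simpa [hi, Function.comp_def] using (measurable_pi_apply i).comp measurable_snd
  refine ⟨hm, (Measure.pi_eq fun s hs => ?_).symm⟩
  have hpre : (fun p : ℝ × (ι → ℝ) => Function.update p.2 k p.1) ⁻¹' Set.univ.pi s =
      s k ×ˢ Set.univ.pi (Function.update s k Set.univ) := by
    ext p
    simp only [Set.mem_preimage, Set.mem_univ_pi, Set.mem_prod]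
    constructor
    · refine fun h => ⟨by simpa using h k, fun i => ?_⟩
      by_cases hi : i = k
      · subst hi
        simp
      · simpa [hi] using h i
    · rintro ⟨h1, h2⟩ i
      by_cases hi : i = k
      · subst hi
        simpa using h1
      · simpa [hi] using h2 i
  rw [Measure.map_apply hm (MeasurableSet.univ_pi hs), hpre, Measure.prod_prod, Measure.pi_pi,
    ← Finset.mul_prod_erase _ _ (Finset.mem_univ k),
    ← Finset.mul_prod_erase _ (fun i => μ i (s i)) (Finset.mem_univ k)]
  simp only [Function.update_self, measure_univ, one_mul]
  congr 1
  refine Finset.prod_congr rfl fun i hi => ?_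
  rw [Function.update_of_ne (Finset.ne_of_mem_erase hi)]

/-- No integrability is needed: both sides vanish by convention when it fails. -/
lemma integral_pi_mul_coord (k : ι) {B : (ι → ℝ) → ℝ} (hB : Measurable B)
    (hBk : ∀ z t, B (Function.update z k t) = B z) {φ : ℝ → ℝ} (hφ : Measurable φ) :
    ∫ z, B z * φ (z k) ∂Measure.pi μ = (∫ t, φ t ∂μ k) * ∫ z, B z ∂Measure.pi μ := by
  have hmp := measurePreserving_update_pi μ k
  have hmeas : Measurable fun z : ι → ℝ => B z * φ (z k) :=
    hB.mul (hφ.comp (measurable_pi_apply k))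
  rw [← hmp.map_eq, integral_map hmp.measurable.aemeasurable hmeas.aestronglyMeasurable,
    hmp.map_eq, ← integral_prod_mul]
  refine integral_congr_ae (Eventually.of_forall fun p => ?_)
  simp [hBk, mul_comm]
end

/-! ### The one-dimensional ANOVA identity -/

section
variable {μ : Measure ℝ} [IsProbabilityMeasure μ] {g : ℝ → ℝ} {J : Set ℝ} {x : ℝ}

lemma measurable_anovaRatio (μ : Measure ℝ) {g : ℝ → ℝ} (hg : Measurable g) (x : ℝ) :
    Measurable (anovaRatio μ g x) :=
  ((monotone_cdf μ).measurable.sub (measurable_one.indicator measurableSet_Ici)).div hg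

/-- The numerator of the ratio vanishes outside an interval that carries `μ` and contains `x`. -/
lemma cdf_sub_indicator_eq_zero (hJ : J.OrdConnected) (hμJ : μ Jᶜ = 0) (hx : x ∈ J) {t : ℝ}
    (ht : t ∉ J) : cdf μ t - (Set.Ici x).indicator 1 t = 0 := by
  rw [cdf_eq_real]
  rcases lt_or_ge t x with h | h
  · rw [Set.indicator_of_notMem (by simpa using h), sub_zero, measureReal_eq_zero_iff]
    refine measure_mono_null (t := Jᶜ) (fun s hs hsJ => ht ?_) hμJ
    exact hJ.out hsJ hx ⟨hs, h.le⟩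
  · rw [Set.indicator_of_mem (by simpa using h), Pi.one_apply, sub_eq_zero, measureReal_def,
      prob_compl_eq_zero_iff measurableSet_Iic |>.1, ENNReal.toReal_one]
    refine measure_mono_null (t := Jᶜ) (fun s hs hsJ => ht ?_) hμJ
    exact hJ.out hx hsJ ⟨h, (not_le.1 fun h' => hs h').le⟩

lemma integral_indicator_Iic_sub (t : ℝ) (c : ℝ) :
    ∫ s, ((Set.Iic t).indicator (1 : ℝ → ℝ) s - c) ∂μ = cdf μ t - c := by
  rw [integral_sub (f := (Set.Iic t).indicator 1)
      ((integrable_const (1 : ℝ)).indicator measurableSet_Iic) (integrable_const c),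
    integral_indicator_one measurableSet_Iic, cdf_eq_real]
  simp

/-- `f(x) - f(s) = ∫ f'(t) (1[s ≤ t] - 1[x ≤ t]) dt`. -/
lemma integral_deriv_mul_indicator_sub {f f' : ℝ → ℝ} (hf : ∀ t, HasDerivAt f (f' t) t)
    (hf' : Continuous f') (x s : ℝ) :
    ∫ t, f' t * ((Set.Iic t).indicator (1 : ℝ → ℝ) s - (Set.Ici x).indicator 1 t) = f x - f s := by
  have hftc : ∀ a b, ∫ t in a..b, f' t = f b - f a := fun a b =>
    intervalIntegral.integral_eq_sub_of_hasDerivAt (fun t _ => hf t)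
      (hf'.intervalIntegrable _ _)
  rcases le_total s x with h | h
  · have : (fun t => f' t * ((Set.Iic t).indicator (1 : ℝ → ℝ) s - (Set.Ici x).indicator 1 t)) =
        (Set.Ico s x).indicator f' := by
      funext t
      simp only [Set.indicator_apply, Set.mem_Iic, Set.mem_Ici, Set.mem_Ico, Pi.one_apply]
      split_ifs <;> grind
    rw [this, integral_indicator measurableSet_Ico, integral_Ico_eq_integral_Ioo,
      ← integral_Ioc_eq_integral_Ioo, ← intervalIntegral.integral_of_le h, hftc]
  · have : (fun t => f' t * ((Set.Iic t).indicator (1 : ℝ → ℝ) s - (Set.Ici x).indicator 1 t)) =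
        fun t => -(Set.Ico x s).indicator f' t := by
      funext t
      simp only [Set.indicator_apply, Set.mem_Iic, Set.mem_Ici, Set.mem_Ico, Pi.one_apply]
      split_ifs <;> grind
    rw [this, integral_neg, integral_indicator measurableSet_Ico, integral_Ico_eq_integral_Ioo,
      ← integral_Ioc_eq_integral_Ioo, ← intervalIntegral.integral_of_le h, hftc]
    ring

/-- `f(x) = E f(Y) + E[f'(Y) (G(Y) - 1[Y ≥ x]) / g(Y)]` for `Y` of law `μ` with density `g`. The
density cancels, and the identity is Fubini's theorem for the kernel
`f'(t) (1[s ≤ t] - 1[x ≤ t])` against `dt μ(ds)`; its sign in `s` is constant for each `t`, so that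
its integrability is that of the derivative term. -/
lemma eq_integral_add_integral_deriv_mul_anovaRatio (hJ : J.OrdConnected) (hg : Measurable g)
    (hg0 : ∀ t, 0 ≤ g t) (hpos : ∀ᵐ t, 0 < g t ↔ t ∈ J)
    (hμ : μ = volume.withDensity fun t => ENNReal.ofReal (g t)) (hx : x ∈ J)
    {f f' : ℝ → ℝ} (hf : ∀ t, HasDerivAt f (f' t) t) (hf' : Continuous f')
    (hint : Integrable (fun t => f' t * anovaRatio μ g x t) μ) :
    f x = ∫ t, f t ∂μ + ∫ t, f' t * anovaRatio μ g x t ∂μ := by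
  let D : ℝ → ℝ := fun t => cdf μ t - (Set.Ici x).indicator 1 t
  have hJm : MeasurableSet J := hJ.measurableSet
  have hμJ : μ Jᶜ = 0 := by
    rw [hμ, withDensity_apply _ hJm.compl, lintegral_eq_zero_iff (by fun_prop),
      Filter.EventuallyEq, ae_restrict_iff' hJm.compl]
    filter_upwards [hpos] with t ht htJ
    simpa using not_lt.1 fun h => htJ (ht.1 h)
  have hgm : Measurable fun t => ENNReal.ofReal (g t) := hg.ennreal_ofReal
  have hfin : ∀ᵐ t, ENNReal.ofReal (g t) < ⊤ := Eventually.of_forall fun _ => ENNReal.ofReal_lt_top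
  -- where the density vanishes, the quotient is zero by convention, and so is its numerator
  have hcancel : (fun t => (ENNReal.ofReal (g t)).toReal • (f' t * anovaRatio μ g x t)) =ᵐ[volume]
      fun t => f' t * D t := by
    filter_upwards [hpos] with t ht
    rw [ENNReal.toReal_ofReal (hg0 t), smul_eq_mul]
    by_cases h : t ∈ J
    · have := (ht.2 h).ne'
      simp only [anovaRatio, D]
      field_simp
    · have h0 : D t = 0 := cdf_sub_indicator_eq_zero hJ hμJ hx h
      have : anovaRatio μ g x t = 0 := by
        simp only [anovaRatio]
        rw [show cdf μ t - (Set.Ici x).indicator 1 t = 0 from h0, zero_div]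
      rw [this, h0]
      simp
  have hμint : ∫ t, f' t * anovaRatio μ g x t ∂μ = ∫ t, f' t * D t := by
    conv_lhs => rw [hμ]
    rw [integral_withDensity_eq_integral_toReal_smul hgm hfin, ← hμ]
    exact integral_congr_ae hcancel
  have hvol : Integrable (fun t => f' t * D t) := by
    refine Integrable.congr ?_ hcancel
    rw [← integrable_withDensity_iff_integrable_smul' hgm hfin, ← hμ]
    exact hint
  have hset : MeasurableSet {p : ℝ × ℝ | p.2 ≤ p.1} := measurableSet_le measurable_snd measurable_fst
  let K : ℝ × ℝ → ℝ := fun p =>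
    f' p.1 * ((Set.Iic p.1).indicator (1 : ℝ → ℝ) p.2 - (Set.Ici x).indicator 1 p.1)
  have hKm : Measurable K := by
    have h1 : Measurable fun p : ℝ × ℝ => (Set.Iic p.1).indicator (1 : ℝ → ℝ) p.2 :=
      (measurable_one.indicator hset : Measurable ({p : ℝ × ℝ | p.2 ≤ p.1}.indicator (1 : ℝ × ℝ → ℝ)))
    have h2 : Measurable fun p : ℝ × ℝ => (Set.Ici x).indicator (1 : ℝ → ℝ) p.1 :=
      (measurable_one.indicator measurableSet_Ici).comp measurable_fst
    exact (hf'.measurable.comp measurable_fst).mul (h1.sub h2)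
  have hind : ∀ t (c : ℝ), Integrable (fun s => (Set.Iic t).indicator (1 : ℝ → ℝ) s - c) μ :=
    fun t c => ((integrable_const (1 : ℝ)).indicator measurableSet_Iic).sub (integrable_const c)
  have hKnorm : ∀ t, ∫ s, ‖K (t, s)‖ ∂μ = ‖f' t * D t‖ := by
    intro t
    simp only [K, norm_mul]
    rw [integral_const_mul]
    congr 1
    by_cases h : x ≤ t
    · have h1 : (Set.Ici x).indicator (1 : ℝ → ℝ) t = 1 := by simp [h]
      have h2 : ∀ s, (Set.Iic t).indicator (1 : ℝ → ℝ) s - 1 ≤ 0 := fun s => by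
        by_cases hs : s ≤ t <;> simp [hs]
      have h3 : D t ≤ 0 := by
        simp only [D, h1]
        linarith [cdf_le_one μ t]
      simp only [h1, Real.norm_eq_abs, abs_of_nonpos (h2 _), abs_of_nonpos h3]
      rw [integral_neg, integral_indicator_Iic_sub]
      simp only [D, h1]
    · have h1 : (Set.Ici x).indicator (1 : ℝ → ℝ) t = 0 := by simp [h]
      have h2 : ∀ s, 0 ≤ (Set.Iic t).indicator (1 : ℝ → ℝ) s - 0 := fun s => by
        by_cases hs : s ≤ t <;> simp [hs]
      have h3 : 0 ≤ D t := by
        simp only [D, h1]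
        linarith [cdf_nonneg μ t]
      simp only [h1, Real.norm_eq_abs, abs_of_nonneg (h2 _), abs_of_nonneg h3]
      rw [integral_indicator_Iic_sub]
      simp only [D, h1]
  have hKint : Integrable K (volume.prod μ) := by
    rw [integrable_prod_iff hKm.aestronglyMeasurable]
    refine ⟨Eventually.of_forall fun t => (hind t ((Set.Ici x).indicator 1 t)).const_mul (f' t), ?_⟩
    simp only [hKnorm]
    exact hvol.norm
  have hKt : ∀ s, ∫ t, K (t, s) = f x - f s := fun s => integral_deriv_mul_indicator_sub hf hf' x s
  have hKs : ∀ t, ∫ s, K (t, s) ∂μ = f' t * D t := fun t => by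
    simp only [K]
    rw [integral_const_mul, integral_indicator_Iic_sub]
  have hfs : Integrable (fun s => f x - f s) μ := by
    simpa only [hKt] using hKint.integral_prod_right
  have hfi : Integrable f μ := by
    refine ((integrable_const (f x)).sub hfs).congr (Eventually.of_forall fun s => ?_)
    simp
  have hkey : ∫ t, f' t * D t = ∫ s, (f x - f s) ∂μ := by
    simp only [← hKs, ← hKt]
    rw [← integral_prod _ hKint, integral_prod_symm _ hKint]
  rw [hμint, hkey, integral_sub (integrable_const _) hfi]
  simp
end

/-! ### The ANOVA decomposition -/

section
variable {d : ℕ} (μ : Fin d → Measure ℝ) [∀ i, IsProbabilityMeasure (μ i)]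

/-- Freezing the coordinates of `W` at `x` one after the other: each step splits a term, by the
one-dimensional identity in the new coordinate, into a mean and a derivative term. The set `U` of
coordinates that already carry a ratio is what the induction needs. -/
lemma integral_piecewise_eq_sum_mixedPartial {r : Fin d → ℝ → ℝ} (x : Fin d → ℝ)
    (hone : ∀ k, ∀ f f' : ℝ → ℝ, (∀ t, HasDerivAt f (f' t) t) → Continuous f' →
      Integrable (fun t => f' t * r k t) (μ k) →
      f (x k) = ∫ t, f t ∂μ k + ∫ t, f' t * r k t ∂μ k)
    (W U : Finset (Fin d)) (hUW : Disjoint U W) {F : (Fin d → ℝ) → ℝ}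
    (hF : ContDiff ℝ W.card F)
    (hint : ∀ w ⊆ W, Integrable (fun y => mixedPartial w F y * ∏ j ∈ U ∪ w, r j (y j))
      (Measure.pi μ)) :
    Integrable (fun y => F (W.piecewise x y) * ∏ j ∈ U, r j (y j)) (Measure.pi μ) ∧
    ∫ y, F (W.piecewise x y) * ∏ j ∈ U, r j (y j) ∂Measure.pi μ =
      ∑ w ∈ W.powerset, ∫ y, mixedPartial w F y * ∏ j ∈ U ∪ w, r j (y j) ∂Measure.pi μ := by
  induction W using Finset.induction_on_min generalizing U F with
  | empty =>
    have h := hint ∅ subset_rfl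
    simp only [mixedPartial_empty, Finset.union_empty] at h
    simp only [Finset.piecewise_empty, Finset.powerset_empty, Finset.sum_singleton,
      mixedPartial_empty, Finset.union_empty, and_true]
    exact h
  | insert k W hk ih =>
    have hkW : k ∉ W := fun h => (hk k h).false
    have hkU : k ∉ U := fun h => Finset.disjoint_left.1 hUW h (Finset.mem_insert_self k W)
    rw [Finset.card_insert_of_notMem hkW] at hF
    have hF' : ContDiff ℝ W.card (partialDeriv k F) := ContDiff.partialDeriv hF k
    have hmix : ∀ w ⊆ W, mixedPartial (insert k w) F = mixedPartial w (partialDeriv k F) :=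
      fun w hw => mixedPartial_insert fun j hj => hk j (hw hj)
    have hunion : ∀ w : Finset (Fin d), U ∪ insert k w = insert k U ∪ w := fun w => by
      rw [Finset.union_insert, Finset.insert_union]
    obtain ⟨hi1, he1⟩ := ih U (hUW.mono_right (Finset.subset_insert k W))
      (hF.of_le (by exact_mod_cast Nat.le_succ _)) fun w hw =>
      hint w (hw.trans (Finset.subset_insert k W))
    obtain ⟨hi2, he2⟩ := ih (insert k U)
      (Finset.disjoint_insert_left.2 ⟨hkW, hUW.mono_right (Finset.subset_insert k W)⟩) hF'
      fun w hw => by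
        have := hint (insert k w) (Finset.insert_subset_insert k hw)
        rwa [hmix w hw, hunion] at this
    let c : (Fin d → ℝ) → ℝ := fun y => ∏ j ∈ U, r j (y j)
    have hc : ∀ y t, c (Function.update y k t) = c y := fun y t =>
      Finset.prod_congr rfl fun j hj => by
        rw [Function.update_of_ne fun h : j = k => hkU (h ▸ hj)]
    have hpw : ∀ y t, W.piecewise x (Function.update y k t) =
        Function.update (W.piecewise x y) k t := fun y t => by
      funext j
      by_cases hj : j = k
      · subst hj
        simp [hkW]
      · by_cases hjW : j ∈ W <;> simp [hj, hjW]
    have hpw' : ∀ y, (insert k W).piecewise x y = Function.update (W.piecewise x y) k (x k) :=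
      fun y => by rw [Finset.piecewise_insert]
    have hmp := measurePreserving_update_pi μ k
    have hp1 : Integrable (fun p : ℝ × (Fin d → ℝ) =>
        F (Function.update (W.piecewise x p.2) k p.1) * c p.2) ((μ k).prod (Measure.pi μ)) := by
      refine (hmp.integrable_comp_of_integrable hi1).congr (Eventually.of_forall fun p => ?_)
      change F (W.piecewise x (Function.update p.2 k p.1)) * c (Function.update p.2 k p.1) = _
      rw [hpw, hc]
    have hins : ∀ y t, ∏ j ∈ insert k U, r j (Function.update y k t j) = r k t * c y := fun y t => by
      rw [Finset.prod_insert hkU, Function.update_self]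
      exact congrArg (r k t * ·) (hc y t)
    have hp2 : Integrable (fun p : ℝ × (Fin d → ℝ) =>
        partialDeriv k F (Function.update (W.piecewise x p.2) k p.1) * r k p.1 * c p.2)
        ((μ k).prod (Measure.pi μ)) := by
      refine (hmp.integrable_comp_of_integrable hi2).congr (Eventually.of_forall fun p => ?_)
      change partialDeriv k F (W.piecewise x (Function.update p.2 k p.1)) *
        ∏ j ∈ insert k U, r j (Function.update p.2 k p.1 j) = _
      rw [hpw, hins, ← mul_assoc]
    -- the one-dimensional identity on almost every line in direction `k`, the other coordinates
    -- being parameters; both sides carry the constant `c y`, which may vanish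
    have hkey : ∀ᵐ y ∂Measure.pi μ, F ((insert k W).piecewise x y) * c y =
        (∫ t, F (Function.update (W.piecewise x y) k t) * c y ∂μ k) +
        ∫ t, partialDeriv k F (Function.update (W.piecewise x y) k t) * r k t * c y ∂μ k := by
      filter_upwards [hp2.prod_left_ae] with y hy
      rw [integral_mul_const, integral_mul_const, ← add_mul, hpw']
      rcases eq_or_ne (c y) 0 with h0 | h0
      · simp [h0]
      · rw [← hone k (fun t => F (Function.update (W.piecewise x y) k t)) _
          (fun t => hasDerivAt_comp_update hF k _ t)]
        · exact hF'.continuous.comp (continuous_const.update k continuous_id)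
        · have := hy.mul_const (c y)⁻¹
          refine this.congr (Eventually.of_forall fun t => ?_)
          simp only
          rw [mul_assoc, mul_inv_cancel₀ h0, mul_one]
    have hj1 := hp1.integral_prod_right
    have hj2 := hp2.integral_prod_right
    refine ⟨(hj1.add hj2).congr (hkey.mono fun y hy => hy.symm), ?_⟩
    have hs1 : ∫ y, F (W.piecewise x y) * c y ∂Measure.pi μ = ∫ y, (∫ t,
        F (Function.update (W.piecewise x y) k t) * c y ∂μ k) ∂Measure.pi μ := by
      rw [← integral_prod_symm _ hp1]
      conv_lhs => rw [← hmp.map_eq]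
      rw [integral_map hmp.measurable.aemeasurable (by rw [hmp.map_eq]; exact hi1.1)]
      refine integral_congr_ae (Eventually.of_forall fun p => ?_)
      simp only [hpw, hc]
    have hs2 : ∫ y, partialDeriv k F (W.piecewise x y) * ∏ j ∈ insert k U, r j (y j)
        ∂Measure.pi μ = ∫ y, (∫ t, partialDeriv k F (Function.update (W.piecewise x y) k t) *
          r k t * c y ∂μ k) ∂Measure.pi μ := by
      rw [← integral_prod_symm _ hp2]
      conv_lhs => rw [← hmp.map_eq]
      rw [integral_map hmp.measurable.aemeasurable (by rw [hmp.map_eq]; exact hi2.1)]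
      refine integral_congr_ae (Eventually.of_forall fun p => ?_)
      simp only [hpw, hins, mul_assoc]
    rw [integral_congr_ae hkey, integral_add hj1 hj2, ← hs1, ← hs2, he1, he2,
      Finset.sum_powerset_insert hkW]
    congr 1
    refine Finset.sum_congr rfl fun w hw => ?_
    rw [hmix w (Finset.mem_powerset.1 hw), hunion]
end

/-! ### Taylor expansion of mixed differences -/

/-- The mixed difference of `M` over `w` is the product of the increments in `w` times the Taylor
expansion of `∂_w M`, with universal coefficients `m` coming from the averaging measure. Every
increment in `w` is a factor of the remainder too; this is what makes the final error
`O(‖h‖ ^ (2 * α))` without any restriction on the ratios of the coordinates of `h`. -/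
lemma exists_mixedDifference_taylor {d : ℕ} (w : Finset (Fin d)) :
    ∃ m : (j : ℕ) → (Fin j → Fin d) → ℝ, (∀ q, m 0 q = 1) ∧
      ∀ (n : ℕ) (M : (Fin d → ℝ) → ℝ), 0 < n → ContDiff ℝ (n + w.card : ℕ) M →
        ∀ (y t : Fin d → ℝ) (B : ℝ),
          (∀ t' : Fin d → ℝ, (∀ k, |t' k| ≤ |t k|) →
            ‖iteratedFDeriv ℝ (n + w.card) M (y + t')‖ ≤ B) →
          |∑ v ∈ w.powerset, (-1) ^ v.card * M (y + v.piecewise 0 t) -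
            (∏ k ∈ w, t k) * ∑ j ∈ Finset.range n, ∑ q : Fin j → Fin d,
              m j q * (∏ i, t (q i)) * ((j.factorial : ℝ)⁻¹ *
                iteratedFDeriv ℝ j (mixedPartial w M) y (fun i => Pi.single (q i) 1))| ≤
            (∏ k ∈ w, |t k|) * (B * ‖t‖ ^ n) := by
  obtain ⟨ν, hνp, hν, hνM⟩ := exists_average_mixedPartial w
  refine ⟨fun j q => ∫ s, ∏ i, s (q i) ∂ν, fun q => by simp, fun n M hn hM y t B hB => ?_⟩
  have hF : ContDiff ℝ n (mixedPartial w M) := ContDiff.mixedPartial w hM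
  have hFc : Continuous fun s => mixedPartial w M (y + s * t) :=
    hF.continuous.comp (by fun_prop)
  rw [hνM M (hM.of_le (by exact_mod_cast Nat.le_add_left _ _)) y t, ← mul_sub, abs_mul,
    Finset.abs_prod]
  refine mul_le_mul_of_nonneg_left ?_ (Finset.prod_nonneg fun k _ => abs_nonneg _)
  have hB0 : 0 ≤ B := (norm_nonneg _).trans (hB 0 fun k => by simp)
  let b : (j : ℕ) → (Fin j → Fin d) → ℝ := fun j q => (j.factorial : ℝ)⁻¹ *
    iteratedFDeriv ℝ j (mixedPartial w M) y (fun i => Pi.single (q i) 1)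
  have hpi : ∀ (j : ℕ) (q : Fin j → Fin d), Integrable
      (fun s : Fin d → ℝ => (∏ i, (s * t) (q i)) * b j q) ν := fun j q =>
    integrable_of_ae_mem_Icc hν (by simp only [Pi.mul_apply]; fun_prop)
  have hpoly : ∑ j ∈ Finset.range n, ∑ q : Fin j → Fin d,
      (∫ s, ∏ i, s (q i) ∂ν) * (∏ i, t (q i)) * b j q =
      ∫ s, ∑ j ∈ Finset.range n, ∑ q : Fin j → Fin d, (∏ i, (s * t) (q i)) * b j q ∂ν := by
    rw [integral_finsetSum _ fun j _ => integrable_finsetSum _ fun q _ => hpi j q]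
    refine Finset.sum_congr rfl fun j _ => ?_
    rw [integral_finsetSum _ fun q _ => hpi j q]
    refine Finset.sum_congr rfl fun q _ => ?_
    simp only [Pi.mul_apply, Finset.prod_mul_distrib]
    rw [integral_mul_const, integral_mul_const]
  change |_ - ∑ j ∈ Finset.range n, ∑ q : Fin j → Fin d,
      (∫ s, ∏ i, s (q i) ∂ν) * (∏ i, t (q i)) * b j q| ≤ _
  rw [hpoly, ← integral_sub (integrable_of_ae_mem_Icc hν hFc)
    (integrable_finsetSum _ fun j _ => integrable_finsetSum _ fun q _ => hpi j q)]
  have hbound := norm_integral_le_of_norm_le_const (μ := ν) (C := B * ‖t‖ ^ n)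
    (f := fun s => mixedPartial w M (y + s * t) -
      ∑ j ∈ Finset.range n, ∑ q : Fin j → Fin d, (∏ i, (s * t) (q i)) * b j q) ?_
  · simpa using hbound
  filter_upwards [hν] with s hs
  have hst : ∀ k, |(s * t) k| ≤ |t k| := fun k => by
    rw [Pi.mul_apply, abs_mul, abs_of_nonneg (hs.1 k)]
    exact mul_le_of_le_one_left (abs_nonneg _) (hs.2 k)
  refine (abs_sub_taylor_le hn hF y (s * t) (B := B) fun τ hτ => ?_).trans ?_
  · refine (norm_iteratedFDeriv_mixedPartial_le w hM _).trans (hB _ fun k => ?_)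
    rw [Pi.smul_apply, smul_eq_mul, abs_mul, abs_of_nonneg hτ.1]
    exact (mul_le_of_le_one_left (abs_nonneg _) hτ.2).trans (hst k)
  · have : ‖s * t‖ ≤ ‖t‖ := (pi_norm_le_iff_of_nonneg (norm_nonneg _)).2 fun k =>
      (hst k).trans (norm_le_pi_norm t k)
    gcongr

/-! ### Moments of the perturbation -/

section
variable {S : Type*} [MeasurableSpace S] {P : Measure S} [IsProbabilityMeasure P]

lemma integral_mul_coord_of_iIndepFun {ι : Type*} [Fintype ι] [DecidableEq ι] {Z : ι → S → ℝ}
    (hZ : ∀ i, Measurable (Z i)) (hind : iIndepFun Z P) (k : ι) {B : (ι → ℝ) → ℝ}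
    (hB : Measurable B) (hBk : ∀ z t, B (Function.update z k t) = B z) {φ : ℝ → ℝ}
    (hφ : Measurable φ) :
    ∫ ω, B (fun i => Z i ω) * φ (Z k ω) ∂P =
      (∫ ω, φ (Z k ω) ∂P) * ∫ ω, B (fun i => Z i ω) ∂P := by
  have hZm : Measurable fun ω i => Z i ω := measurable_pi_lambda _ hZ
  have hlaw := (iIndepFun_iff_map_fun_eq_pi_map fun i => (hZ i).aemeasurable).1 hind
  have hp : ∀ i, IsProbabilityMeasure (P.map (Z i)) := fun i =>
    Measure.isProbabilityMeasure_map (hZ i).aemeasurable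
  have h := integral_pi_mul_coord (fun i => P.map (Z i)) k hB hBk hφ
  have hm : Measurable fun z : ι → ℝ => B z * φ (z k) := hB.mul (hφ.comp (measurable_pi_apply k))
  rw [← hlaw, integral_map hZm.aemeasurable hm.aestronglyMeasurable,
    integral_map hZm.aemeasurable hB.aestronglyMeasurable,
    integral_map (hZ k).aemeasurable hφ.aestronglyMeasurable] at h
  exact h

variable {d : ℕ} {X V : Fin d → S → ℝ} {σ : ℝ}

lemma Perturbation.integral_odd {P : Measure S} (hV : Perturbation P σ V) (k : Fin d) {e : ℕ} (he : Odd e) :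
    ∫ ω, V k ω ^ e ∂P = 0 := by
  obtain ⟨q, rfl⟩ := he
  rcases Nat.eq_zero_or_pos q with rfl | hq
  · simpa using hV.mean_zero k
  · exact hV.odd_moment k q hq

lemma measurable_sumElim (hX : ∀ j, Measurable (X j)) (hV : ∀ j, Measurable (V j)) :
    ∀ i, Measurable (Sum.elim X V i) := by
  rintro (i | i)
  · exact hX i
  · exact hV i

/-- A monomial in `V` with an odd exponent has mean zero, also after multiplication by a function
of `X`. -/
lemma integral_mul_prod_pow_eq_zero (hX : ∀ j, Measurable (X j)) (hV : Perturbation P σ V)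
    (hind : iIndepFun (Sum.elim X V) P) {G : (Fin d → ℝ) → ℝ} (hG : Measurable G)
    (e : Fin d → ℕ) {k : Fin d} (hk : Odd (e k)) :
    ∫ ω, G (fun j => X j ω) * ∏ j, V j ω ^ e j ∂P = 0 := by
  have h := integral_mul_coord_of_iIndepFun (measurable_sumElim hX hV.measurable_coord) hind
    (Sum.inr k) (B := fun z => G (fun j => z (Sum.inl j)) *
      ∏ j ∈ Finset.univ.erase k, z (Sum.inr j) ^ e j)
    (hB := by fun_prop) (φ := fun t => t ^ e k) (hφ := by fun_prop) ?_
  · simp only [Sum.elim_inl, Sum.elim_inr, hV.integral_odd k hk, zero_mul] at h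
    rw [← h]
    refine integral_congr_ae (Eventually.of_forall fun ω => ?_)
    simp only
    rw [← Finset.mul_prod_erase _ _ (Finset.mem_univ k)]
    ring
  · intro z t
    simp only [ne_eq, reduceCtorEq, not_false_eq_true, Function.update_of_ne]
    congr 1
    refine Finset.prod_congr rfl fun j hj => ?_
    rw [Function.update_of_ne]
    simpa using Finset.ne_of_mem_erase hj

lemma integral_mul_prod_sq (hX : ∀ j, Measurable (X j)) (hV : Perturbation P σ V)
    (hind : iIndepFun (Sum.elim X V) P) {G : (Fin d → ℝ) → ℝ} (hG : Measurable G)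
    (w : Finset (Fin d)) :
    ∫ ω, G (fun j => X j ω) * ∏ j ∈ w, V j ω ^ 2 ∂P =
      (σ ^ 2) ^ w.card * ∫ ω, G (fun j => X j ω) ∂P := by
  induction w using Finset.induction_on with
  | empty => simp
  | insert k w hk ih =>
    have h := integral_mul_coord_of_iIndepFun (measurable_sumElim hX hV.measurable_coord) hind
      (Sum.inr k) (B := fun z => G (fun j => z (Sum.inl j)) * ∏ j ∈ w, z (Sum.inr j) ^ 2)
      (hB := by fun_prop) (φ := fun t => t ^ 2) (hφ := by fun_prop) ?_
    · simp only [Sum.elim_inl, Sum.elim_inr, hV.second_moment k] at h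
      rw [Finset.card_insert_of_notMem hk, pow_succ', mul_assoc, ← ih, ← h]
      refine integral_congr_ae (Eventually.of_forall fun ω => ?_)
      simp only
      rw [Finset.prod_insert hk]
      ring
    · intro z t
      simp only [ne_eq, reduceCtorEq, not_false_eq_true, Function.update_of_ne]
      congr 1
      refine Finset.prod_congr rfl fun j hj => ?_
      rw [Function.update_of_ne]
      simpa using fun h : j = k => hk (h ▸ hj)

/-- Homogeneous parts of odd degree in `V` have mean zero. -/
lemma integral_mul_prod_sq_mul_prod_word_eq_zero (hX : ∀ j, Measurable (X j))
    (hV : Perturbation P σ V) (hind : iIndepFun (Sum.elim X V) P) {G : (Fin d → ℝ) → ℝ}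
    (hG : Measurable G) (w : Finset (Fin d)) {j : ℕ} (hj : Odd j) (q : Fin j → Fin d) :
    ∫ ω, G (fun k => X k ω) * ((∏ k ∈ w, V k ω ^ 2) * ∏ i, V (q i) ω) ∂P = 0 := by
  let c : Fin d → ℕ := fun k => (Finset.univ.filter fun i => q i = k).card
  let e : Fin d → ℕ := fun k => (if k ∈ w then 2 else 0) + c k
  obtain ⟨k, hk⟩ : ∃ k, Odd (c k) := by
    by_contra! hcon
    have hsum : j = ∑ k, c k := by
      have := Finset.card_eq_sum_card_fiberwise (s := (Finset.univ : Finset (Fin j)))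
        (t := Finset.univ) (f := q) (fun _ _ => Finset.mem_coe.2 (Finset.mem_univ _))
      simpa using this
    have heven : Even (∑ k, c k) := Finset.even_sum _ fun k _ => by
      simpa using hcon k
    rw [← hsum] at heven
    exact (Nat.not_even_iff_odd.2 hj) heven
  have he : Odd (e k) := by
    by_cases hkw : k ∈ w
    · simpa [e, hkw] using Even.add_odd even_two hk
    · simpa [e, hkw] using hk
  rw [← integral_mul_prod_pow_eq_zero hX hV hind hG e he]
  refine integral_congr_ae (Eventually.of_forall fun ω => ?_)
  simp only [e, pow_add, Finset.prod_mul_distrib]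
  congr 2
  · rw [← Finset.prod_subset (Finset.subset_univ w) fun k _ hk => by simp [hk]]
    exact Finset.prod_congr rfl fun k hk => by simp [hk]
  · rw [← Finset.prod_fiberwise (s := Finset.univ) (g := q)]
    refine Finset.prod_congr rfl fun k _ => ?_
    rw [Finset.prod_congr rfl fun i hi => by rw [(Finset.mem_filter.1 hi).2], Finset.prod_const]

/-- Switching off the increment of a coordinate `k ∈ w` leaves `V k` as an independent centred
factor. -/
lemma integral_piecewise_mul_prod_eq_zero (hX : ∀ j, Measurable (X j))
    (hV : Perturbation P σ V) (hind : iIndepFun (Sum.elim X V) P) {M : (Fin d → ℝ) → ℝ}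
    (hM : Measurable M) {r : Fin d → ℝ → ℝ} (hr : ∀ k, Measurable (r k)) (a : Fin d → ℝ)
    {v w : Finset (Fin d)} {k : Fin d} (hkv : k ∈ v) (hkw : k ∈ w) :
    ∫ ω, M ((fun j => X j ω) + v.piecewise 0 (fun j => a j * V j ω)) *
      ∏ j ∈ w, (r j (X j ω) * V j ω) ∂P = 0 := by
  have hpw : Measurable fun z : Fin d ⊕ Fin d → ℝ =>
      (fun j => z (Sum.inl j)) + v.piecewise 0 (fun j => a j * z (Sum.inr j)) := by
    refine measurable_pi_lambda _ fun j => ?_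
    by_cases hj : j ∈ v
    · simp only [Pi.add_apply, Finset.piecewise_eq_of_mem _ _ _ hj, Pi.zero_apply]
      fun_prop
    · simp only [Pi.add_apply, Finset.piecewise_eq_of_notMem _ _ _ hj]
      fun_prop
  let B : (Fin d ⊕ Fin d → ℝ) → ℝ := fun z =>
    M ((fun j => z (Sum.inl j)) + v.piecewise 0 (fun j => a j * z (Sum.inr j))) *
      ((∏ j ∈ w, r j (z (Sum.inl j))) * ∏ j ∈ w.erase k, z (Sum.inr j))
  have hBm : Measurable B := by
    refine (hM.comp hpw).mul (Measurable.mul ?_ (by fun_prop))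
    exact Finset.measurable_prod _ fun j _ => (hr j).comp (measurable_pi_apply _)
  have h := integral_mul_coord_of_iIndepFun (measurable_sumElim hX hV.measurable_coord) hind
    (Sum.inr k) hBm (φ := fun t => t) (hφ := measurable_id) ?_
  · simp only [B, Sum.elim_inl, Sum.elim_inr, hV.mean_zero k, zero_mul] at h
    rw [← h]
    refine integral_congr_ae (Eventually.of_forall fun ω => ?_)
    simp only
    rw [Finset.prod_mul_distrib, ← Finset.mul_prod_erase _ (fun j => V j ω) hkw]
    ring
  · intro z t
    simp only [B, ne_eq, reduceCtorEq, not_false_eq_true, Function.update_of_ne]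
    congr 2
    · congr 1
      funext j
      by_cases hj : j ∈ v
      · simp [hj]
      · have : j ≠ k := fun h => hj (h ▸ hkv)
        simp [hj, this]
    · refine Finset.prod_congr rfl fun j hj => ?_
      rw [Function.update_of_ne]
      simpa using Finset.ne_of_mem_erase hj
end

/-! ### Expansion of the expectations in the bandwidths -/

lemma prod_abs_le_one_add_norm_pow {d : ℕ} {κ : Type*} (s : Finset κ) (f : κ → Fin d)
    (V : Fin d → ℝ) : ∏ i ∈ s, |V (f i)| ≤ (1 + ‖V‖) ^ s.card := by
  rw [← Finset.prod_const]
  refine Finset.prod_le_prod (fun i _ => abs_nonneg _) fun i _ => ?_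
  have := norm_le_pi_norm V (f i)
  rw [Real.norm_eq_abs] at this
  linarith

section
variable {S : Type*} [MeasurableSpace S] {P : Measure S} {d : ℕ} {X V : Fin d → S → ℝ} {σ : ℝ}

/-- The form in which the domination hypothesis is used: `A` stands for a derivative of `M`, `Y` for
a monomial in `V`, and `ρ` for a product of ratios. -/
lemma integrable_mul_of_dominated {Φ A Y ρ : S → ℝ} {N : ℕ} (hA : AEStronglyMeasurable A P)
    (hY : AEStronglyMeasurable Y P) (hρ : AEStronglyMeasurable ρ P)
    (hAΦ : ∀ᵐ ω ∂P, |A ω| ≤ Φ ω) (hYV : ∀ ω, |Y ω| ≤ (1 + ‖fun k => V k ω‖) ^ N)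
    (hint : Integrable (fun ω => Φ ω * (1 + ‖fun k => V k ω‖) ^ N * |ρ ω|) P) :
    Integrable (fun ω => A ω * ρ ω * Y ω) P := by
  refine hint.mono' ((hA.mul hρ).mul hY) ?_
  filter_upwards [hAΦ] with ω hω
  rw [Real.norm_eq_abs, abs_mul, abs_mul]
  calc |A ω| * |ρ ω| * |Y ω| = |A ω| * |Y ω| * |ρ ω| := by ring
    _ ≤ Φ ω * (1 + ‖fun k => V k ω‖) ^ N * |ρ ω| := by
      have h0 := (abs_nonneg (A ω)).trans hω
      have := hYV ω
      gcongr

/-- Expansion of `E[M(X + a V) ∏_{k ∈ w} r_k(X_k) V_k]` in the steps `a`. All terms with an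
increment switched off in `w` have mean zero, so the expectation is that of a mixed difference
over `w`, and the terms of odd degree in its Taylor expansion have mean zero. -/
lemma exists_expansion_integral_mul_prod [IsProbabilityMeasure P] (hX : ∀ j, Measurable (X j))
    (hV : Perturbation P σ V) (hind : iIndepFun (Sum.elim X V) P) {r : Fin d → ℝ → ℝ}
    (hr : ∀ k, Measurable (r k)) (w : Finset (Fin d)) {n N : ℕ} (hn : 0 < n)
    (hN : 2 * w.card + n ≤ N) {M : (Fin d → ℝ) → ℝ} (hM : ContDiff ℝ (n + w.card : ℕ) M)
    {ε : ℝ} (hε : 0 < ε) {Φ : S → ℝ}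
    (hdom : ∀ᵐ ω ∂P, ∀ t : Fin d → ℝ, (∀ k, |t k| ≤ ε * |V k ω|) → ∀ i ≤ n + w.card,
      ‖iteratedFDeriv ℝ i M (fun k => X k ω + t k)‖ ≤ Φ ω)
    (hint : Integrable (fun ω => Φ ω * (1 + ‖fun k => V k ω‖) ^ N *
      ∏ k ∈ w, |r k (X k ω)|) P) :
    ∃ c : (j : ℕ) → (Fin j → Fin d) → ℝ, (∀ j q, Odd j → c j q = 0) ∧
      (∀ q, c 0 q = (σ ^ 2) ^ w.card *
        ∫ ω, mixedPartial w M (fun k => X k ω) * ∏ k ∈ w, r k (X k ω) ∂P) ∧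
      ∃ K : ℝ, ∀ a : Fin d → ℝ, (∀ k, |a k| ≤ ε) →
        Integrable (fun ω => M (fun k => X k ω + a k * V k ω) *
          ∏ k ∈ w, (r k (X k ω) * V k ω)) P ∧
        |∫ ω, M (fun k => X k ω + a k * V k ω) * ∏ k ∈ w, (r k (X k ω) * V k ω) ∂P -
          (∏ k ∈ w, a k) * ∑ j ∈ Finset.range n, ∑ q : Fin j → Fin d,
            (∏ i, a (q i)) * c j q| ≤ (∏ k ∈ w, |a k|) * ‖a‖ ^ n * K := by
  obtain ⟨m, hm0, hm⟩ := exists_mixedDifference_taylor w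
  have hVm := hV.measurable_coord
  have hMc : Continuous M := hM.continuous
  have hF : ContDiff ℝ n (mixedPartial w M) := ContDiff.mixedPartial w hM
  have hXm : Measurable fun ω k => X k ω := measurable_pi_lambda _ hX
  have hρm : Measurable fun ω => ∏ k ∈ w, r k (X k ω) :=
    Finset.measurable_prod _ fun k _ => (hr k).comp (hX k)
  have hint' : Integrable (fun ω => Φ ω * (1 + ‖fun k => V k ω‖) ^ N *
      |∏ k ∈ w, r k (X k ω)|) P := by
    simpa only [Finset.abs_prod] using hint
  have hone : ∀ ω, 1 ≤ 1 + ‖fun k => V k ω‖ := fun ω => by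
    linarith [norm_nonneg fun k => V k ω]
  let b : (j : ℕ) → (Fin j → Fin d) → (Fin d → ℝ) → ℝ := fun j q y => (j.factorial : ℝ)⁻¹ *
    iteratedFDeriv ℝ j (mixedPartial w M) y (fun i => Pi.single (q i) 1)
  have hbc : ∀ j < n, ∀ q, Continuous (b j q) := by
    intro j hj q
    have h1 : Continuous (iteratedFDeriv ℝ j (mixedPartial w M)) :=
      hF.continuous_iteratedFDeriv (by exact_mod_cast hj.le)
    exact continuous_const.mul
      ((ContinuousMultilinearMap.apply ℝ (fun _ : Fin j => Fin d → ℝ) ℝ _).continuous.comp h1)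
  have hbΦ : ∀ j < n, ∀ q, ∀ᵐ ω ∂P, |b j q (fun k => X k ω)| ≤ Φ ω := by
    intro j hj q
    filter_upwards [hdom] with ω hω
    have h1 : ‖iteratedFDeriv ℝ j (mixedPartial w M) (fun k => X k ω)‖ ≤ Φ ω := by
      refine (norm_iteratedFDeriv_mixedPartial_le w
        (hM.of_le (by exact_mod_cast Nat.add_le_add_right hj.le _)) _).trans ?_
      simpa using hω 0 (fun k => by simp only [Pi.zero_apply, abs_zero]; positivity) (j + w.card)
        (by omega)
    have h2 := (iteratedFDeriv ℝ j (mixedPartial w M) (fun k => X k ω)).le_opNorm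
      (fun i => Pi.single (q i) 1)
    simp only [Pi.norm_single, norm_one, Finset.prod_const_one, mul_one] at h2
    have h3 : (j.factorial : ℝ)⁻¹ ≤ 1 :=
      inv_le_one_of_one_le₀ (by exact_mod_cast Nat.one_le_iff_ne_zero.2 j.factorial_ne_zero)
    simp only [b]
    rw [abs_mul, abs_of_nonneg (by positivity)]
    calc _ ≤ 1 * Φ ω := mul_le_mul h3 (h2.trans h1) (abs_nonneg _) zero_le_one
      _ = _ := one_mul _
  let G : (j : ℕ) → (Fin j → Fin d) → (Fin d → ℝ) → ℝ := fun j q y =>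
    b j q y * ∏ k ∈ w, r k (y k)
  have hGm : ∀ j < n, ∀ q, Measurable (G j q) := fun j hj q =>
    (hbc j hj q).measurable.mul
      (Finset.measurable_prod _ fun k _ => (hr k).comp (measurable_pi_apply k))
  let T : (j : ℕ) → (Fin j → Fin d) → S → ℝ := fun j q ω =>
    G j q (fun k => X k ω) * ((∏ k ∈ w, V k ω ^ 2) * ∏ i, V (q i) ω)
  have hTint : ∀ j < n, ∀ q, Integrable (T j q) P := by
    intro j hj q
    refine integrable_mul_of_dominated ((hbc j hj q).measurable.comp hXm).aestronglyMeasurable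
      (by fun_prop) hρm.aestronglyMeasurable (hbΦ j hj q) (fun ω => ?_) hint'
    rw [abs_mul, Finset.abs_prod, Finset.abs_prod]
    simp only [abs_pow, Finset.prod_pow]
    have h1 := prod_abs_le_one_add_norm_pow w id (fun k => V k ω)
    have h2 := prod_abs_le_one_add_norm_pow Finset.univ q (fun k => V k ω)
    simp only [id, Finset.card_univ, Fintype.card_fin] at h1 h2
    calc _ ≤ ((1 + ‖fun k => V k ω‖) ^ w.card) ^ 2 * (1 + ‖fun k => V k ω‖) ^ j := by
          gcongr
      _ = (1 + ‖fun k => V k ω‖) ^ (w.card * 2 + j) := by rw [← pow_mul, ← pow_add]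
      _ ≤ _ := pow_le_pow_right₀ (hone ω) (by omega)
  -- `if` discards the degrees beyond the order of differentiability
  refine ⟨fun j q => if j < n then m j q * ∫ ω, T j q ω ∂P else 0, fun j q hj => ?_, fun q => ?_,
    ∫ ω, Φ ω * (1 + ‖fun k => V k ω‖) ^ N * ∏ k ∈ w, |r k (X k ω)| ∂P, fun a ha => ?_⟩
  · beta_reduce
    by_cases hjn : j < n
    · rw [if_pos hjn]
      simp only [T]
      rw [integral_mul_prod_sq_mul_prod_word_eq_zero hX hV hind (hGm j hjn q) w hj q, mul_zero]
    · exact if_neg hjn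
  · beta_reduce
    rw [if_pos hn, hm0, one_mul]
    have := integral_mul_prod_sq hX hV hind (hGm 0 hn q) w
    simp only [T, Finset.univ_eq_empty, Finset.prod_empty, mul_one]
    rw [this]
    simp [G, b]
  let t : S → Fin d → ℝ := fun ω k => a k * V k ω
  have ht : ∀ ω k, |t ω k| ≤ ε * |V k ω| := fun ω k => by
    simp only [t, abs_mul]
    exact mul_le_mul_of_nonneg_right (ha k) (abs_nonneg _)
  have hMv : ∀ v : Finset (Fin d), Integrable (fun ω =>
      M ((fun k => X k ω) + v.piecewise 0 (t ω)) * ∏ k ∈ w, (r k (X k ω) * V k ω)) P := by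
    intro v
    have htm : Measurable fun ω => (fun k => X k ω) + v.piecewise 0 (t ω) := by
      refine measurable_pi_lambda _ fun k => ?_
      by_cases hk : k ∈ v
      · simpa [hk] using hX k
      · have : Measurable fun ω => X k ω + a k * V k ω := (hX k).add ((hVm k).const_mul (a k))
        simpa [hk, t] using this
    have h := integrable_mul_of_dominated (V := V) (P := P) (N := N) (Φ := Φ)
      (A := fun ω => M ((fun k => X k ω) + v.piecewise 0 (t ω)))
      (Y := fun ω => ∏ k ∈ w, V k ω) (ρ := fun ω => ∏ k ∈ w, r k (X k ω))
      (hMc.measurable.comp htm).aestronglyMeasurable (by fun_prop) hρm.aestronglyMeasurable ?_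
      (fun ω => ?_) hint'
    · refine h.congr (Eventually.of_forall fun ω => ?_)
      simp only [Finset.prod_mul_distrib, mul_assoc]
    · filter_upwards [hdom] with ω hω
      have := hω (v.piecewise 0 (t ω)) (fun k => ?_) 0 (Nat.zero_le _)
      · rwa [norm_iteratedFDeriv_zero, Real.norm_eq_abs] at this
      · by_cases hk : k ∈ v
        · simp only [hk, Finset.piecewise_eq_of_mem, Pi.zero_apply, abs_zero]
          positivity
        · simpa [hk] using ht ω k
    · rw [Finset.abs_prod]
      refine (prod_abs_le_one_add_norm_pow w id (fun k => V k ω)).trans ?_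
      exact pow_le_pow_right₀ (hone ω) (by omega)
  have hMt : ∀ ω, M ((fun k => X k ω) + (∅ : Finset (Fin d)).piecewise 0 (t ω)) =
      M (fun k => X k ω + a k * V k ω) := fun ω => by
    rw [Finset.piecewise_empty]
    rfl
  have hM0 := hMv ∅
  simp only [hMt] at hM0
  refine ⟨hM0, ?_⟩
  have hdiffint : ∀ v ∈ w.powerset, Integrable (fun ω => (-1) ^ v.card *
      (M ((fun k => X k ω) + v.piecewise 0 (t ω)) * ∏ k ∈ w, (r k (X k ω) * V k ω))) P :=
    fun v _ => (hMv v).const_mul _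
  have hdiff : ∫ ω, ∑ v ∈ w.powerset, (-1) ^ v.card *
      (M ((fun k => X k ω) + v.piecewise 0 (t ω)) * ∏ k ∈ w, (r k (X k ω) * V k ω)) ∂P =
      ∫ ω, M (fun k => X k ω + a k * V k ω) * ∏ k ∈ w, (r k (X k ω) * V k ω) ∂P := by
    rw [integral_finsetSum _ hdiffint, Finset.sum_eq_single_of_mem ∅ (Finset.empty_mem_powerset w)]
    · simp only [hMt, Finset.card_empty, pow_zero, one_mul]
    · intro v hv hv0
      obtain ⟨k, hk⟩ := Finset.nonempty_iff_ne_empty.2 hv0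
      rw [integral_const_mul, integral_piecewise_mul_prod_eq_zero hX hV hind hMc.measurable hr a hk
        (Finset.mem_powerset.1 hv hk), mul_zero]
  have hTsum : ∀ j ∈ Finset.range n, ∀ q ∈ (Finset.univ : Finset (Fin j → Fin d)),
      Integrable (fun ω => (∏ i, a (q i)) * (m j q * T j q ω)) P := fun j hj q _ =>
    ((hTint j (Finset.mem_range.1 hj) q).const_mul _).const_mul _
  have hpoly : (∏ k ∈ w, a k) * ∑ j ∈ Finset.range n, ∑ q : Fin j → Fin d,
      (∏ i, a (q i)) * (if j < n then m j q * ∫ ω, T j q ω ∂P else 0) =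
      ∫ ω, (∏ k ∈ w, a k) * ∑ j ∈ Finset.range n, ∑ q : Fin j → Fin d,
        (∏ i, a (q i)) * (m j q * T j q ω) ∂P := by
    rw [integral_const_mul, integral_finsetSum _ fun j hj => integrable_finsetSum _ (hTsum j hj)]
    congr 1
    refine Finset.sum_congr rfl fun j hj => ?_
    rw [integral_finsetSum _ (hTsum j hj)]
    refine Finset.sum_congr rfl fun q _ => ?_
    rw [if_pos (Finset.mem_range.1 hj), integral_const_mul, integral_const_mul]
  rw [← hdiff, hpoly, ← integral_sub (integrable_finsetSum _ hdiffint)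
    ((integrable_finsetSum _ fun j hj => integrable_finsetSum _ (hTsum j hj)).const_mul _),
    ← integral_const_mul, ← Real.norm_eq_abs]
  refine norm_integral_le_of_norm_le (hint.const_mul _) ?_
  filter_upwards [hdom] with ω hω
  have hkey := hm n M hn hM (fun k => X k ω) (t ω) (Φ ω) fun t' ht' =>
    hω t' (fun k => (ht' k).trans (ht ω k)) _ le_rfl
  have hΦ0 : 0 ≤ Φ ω := (norm_nonneg _).trans (hω 0 (fun k => by
    simp only [Pi.zero_apply, abs_zero]; positivity) 0 (Nat.zero_le _))
  have hfactor : ∑ v ∈ w.powerset, (-1) ^ v.card *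
      (M ((fun k => X k ω) + v.piecewise 0 (t ω)) * ∏ k ∈ w, (r k (X k ω) * V k ω)) -
      (∏ k ∈ w, a k) * ∑ j ∈ Finset.range n, ∑ q : Fin j → Fin d,
        (∏ i, a (q i)) * (m j q * T j q ω) =
      (∑ v ∈ w.powerset, (-1) ^ v.card * M ((fun k => X k ω) + v.piecewise 0 (t ω)) -
        (∏ k ∈ w, t ω k) * ∑ j ∈ Finset.range n, ∑ q : Fin j → Fin d,
          m j q * (∏ i, t ω (q i)) * b j q (fun k => X k ω)) *
        ∏ k ∈ w, (r k (X k ω) * V k ω) := by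
    rw [sub_mul, Finset.sum_mul]
    congr 1
    · exact Finset.sum_congr rfl fun v _ => by ring
    · simp only [Finset.mul_sum, Finset.sum_mul]
      refine Finset.sum_congr rfl fun j _ => Finset.sum_congr rfl fun q _ => ?_
      simp only [T, G, t, Finset.prod_mul_distrib, Finset.prod_pow]
      ring
  rw [hfactor, norm_mul, Real.norm_eq_abs, Real.norm_eq_abs]
  have htn : ‖t ω‖ ≤ ‖a‖ * (1 + ‖fun k => V k ω‖) := by
    refine (pi_norm_le_iff_of_nonneg (by positivity)).2 fun k => ?_
    simp only [t, norm_mul]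
    refine mul_le_mul (norm_le_pi_norm a k) ?_ (norm_nonneg _) (norm_nonneg _)
    linarith [norm_le_pi_norm (fun k => V k ω) k]
  have hVw := prod_abs_le_one_add_norm_pow w id (fun k => V k ω)
  simp only [id] at hVw
  have hpn : 0 ≤ ∏ k ∈ w, |a k| := Finset.prod_nonneg fun k _ => abs_nonneg _
  have hrn : 0 ≤ ∏ k ∈ w, |r k (X k ω)| := Finset.prod_nonneg fun k _ => abs_nonneg _
  have hvn : 0 ≤ ∏ k ∈ w, |V k ω| := Finset.prod_nonneg fun k _ => abs_nonneg _
  calc _ ≤ (∏ k ∈ w, |t ω k|) * (Φ ω * ‖t ω‖ ^ n) * |∏ k ∈ w, (r k (X k ω) * V k ω)| :=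
        mul_le_mul_of_nonneg_right hkey (abs_nonneg _)
    _ = (∏ k ∈ w, |a k|) * (∏ k ∈ w, |V k ω|) * (Φ ω * ‖t ω‖ ^ n) *
          ((∏ k ∈ w, |r k (X k ω)|) * ∏ k ∈ w, |V k ω|) := by
        simp only [t, Finset.abs_prod, abs_mul, Finset.prod_mul_distrib]
    _ ≤ (∏ k ∈ w, |a k|) * (1 + ‖fun k => V k ω‖) ^ w.card *
          (Φ ω * (‖a‖ * (1 + ‖fun k => V k ω‖)) ^ n) *
          ((∏ k ∈ w, |r k (X k ω)|) * (1 + ‖fun k => V k ω‖) ^ w.card) := by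
        gcongr
    _ = (∏ k ∈ w, |a k|) * ‖a‖ ^ n * (Φ ω * (1 + ‖fun k => V k ω‖) ^ (2 * w.card + n) *
          ∏ k ∈ w, |r k (X k ω)|) := by
        rw [mul_pow, pow_add, two_mul, pow_add]
        ring
    _ ≤ _ := by
        have := pow_le_pow_right₀ (hone ω) hN
        gcongr
end

/-! ### The coefficients -/

/-- The coefficients for order `p` have to reproduce `t ^ p` at `1` and annihilate
`t ^ (p + 2 * s)` for `0 < s < αd`; only exponents of the parity of `p` matter. For nonzero `β ℓ`
with distinct absolute values, the system with `αd = L` is a Vandermonde system in `β ℓ ^ 2`. In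
every other case one nonzero `β ℓ` suffices for `αd = 1`. -/
lemma exists_moment_coefficients (L : ℕ) (hL : 0 < L) (β : Fin L → ℝ) (hβ0 : ∃ ℓ, β ℓ ≠ 0) :
    ∃ αd : ℕ, 1 ≤ αd ∧ αd ≤ L ∧
      ((∀ ℓ, β ℓ ≠ 0) → Function.Injective (fun ℓ => |β ℓ|) → αd = L) ∧
      ∃ C : Fin L → ℕ → ℝ, ∀ p s : ℕ, s < αd →
        ∑ ℓ, C ℓ p * β ℓ ^ (p + 2 * s) = if s = 0 then 1 else 0 := by
  by_cases hgood : (∀ ℓ, β ℓ ≠ 0) ∧ Function.Injective fun ℓ => |β ℓ|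
  · obtain ⟨hne, hinj⟩ := hgood
    let A : Matrix (Fin L) (Fin L) ℝ := (Matrix.vandermonde fun ℓ => β ℓ ^ 2).transpose
    have hA : IsUnit A.det := by
      rw [Matrix.det_transpose, isUnit_iff_ne_zero, Matrix.det_vandermonde_ne_zero_iff]
      exact fun i j hij => hinj ((sq_eq_sq_iff_abs_eq_abs _ _).1 hij)
    let e : Fin L → ℝ := fun s => if (s : ℕ) = 0 then 1 else 0
    have hsol : A.mulVec (A⁻¹.mulVec e) = e := by
      rw [Matrix.mulVec_mulVec, Matrix.mul_nonsing_inv _ hA, Matrix.one_mulVec]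
    refine ⟨L, hL, le_rfl, fun _ _ => rfl, fun ℓ p => A⁻¹.mulVec e ℓ / β ℓ ^ p, fun p s hs => ?_⟩
    have h := congrFun hsol ⟨s, hs⟩
    simp only [Matrix.mulVec, dotProduct, A, Matrix.transpose_apply, Matrix.vandermonde_apply,
      e] at h
    rw [← h]
    refine Finset.sum_congr rfl fun ℓ _ => ?_
    have := pow_ne_zero p (hne ℓ)
    simp only [Matrix.mulVec, dotProduct, A, e]
    rw [pow_add, pow_mul]
    field_simp
  · obtain ⟨ℓ₀, hℓ₀⟩ := hβ0
    refine ⟨1, le_rfl, hL, fun h1 h2 => absurd ⟨h1, h2⟩ hgood,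
      fun ℓ p => if ℓ = ℓ₀ then (β ℓ₀ ^ p)⁻¹ else 0, fun p s hs => ?_⟩
    obtain rfl : s = 0 := by omega
    simp [hℓ₀]

/-! ### Surrogates -/

section
variable {S : Type*} [MeasurableSpace S] {P : Measure S} {d : ℕ} {g : Fin d → ℝ → ℝ}
  {X V : Fin d → S → ℝ} {σ : ℝ} {M : (Fin d → ℝ) → ℝ}

lemma surrogateTerm_eq_sum (h x : Fin d → ℝ) (β : ℝ) (p : ℕ) (ω : S) :
    surrogateTerm P g X V σ M h x β p ω = ∑ w ∈ Finset.powersetCard p Finset.univ,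
      M (fun k => X k ω + β * h k * V k ω) * ∏ k ∈ w, randomWeight P g X V σ h x ω k := by
  simp [surrogateTerm, MvPolynomial.esymm, Finset.mul_sum]

lemma prod_randomWeight (h x : Fin d → ℝ) (w : Finset (Fin d)) (ω : S) :
    ∏ k ∈ w, randomWeight P g X V σ h x ω k = ((∏ k ∈ w, h k) * (σ ^ 2) ^ w.card)⁻¹ *
      ∏ k ∈ w, (anovaRatio (P.map (X k)) (g k) (x k) (X k ω) * V k ω) := by
  rw [← Finset.prod_const, ← Finset.prod_mul_distrib, ← Finset.prod_inv_distrib,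
    ← Finset.prod_mul_distrib]
  refine Finset.prod_congr rfl fun k _ => ?_
  simp only [randomWeight]
  ring

/-- The contribution of one set `w` of coordinates: the moment conditions on the coefficients leave
only the leading term of the expansion. -/
lemma exists_surrogate_error_bound [IsProbabilityMeasure P] (hσ : 0 < σ)
    (hX : ∀ j, Measurable (X j)) (hg : ∀ j, Measurable (g j)) (hV : Perturbation P σ V)
    (hind : iIndepFun (Sum.elim X V) P) (x : Fin d → ℝ) (w : Finset (Fin d)) {α : ℕ} (hα : 0 < α)
    (hM : ContDiff ℝ (2 * α + w.card : ℕ) M) {ε : ℝ} (hε : 0 < ε) {Φ : S → ℝ}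
    (hdom : ∀ᵐ ω ∂P, ∀ t : Fin d → ℝ, (∀ k, |t k| ≤ ε * |V k ω|) → ∀ i ≤ 2 * α + w.card,
      ‖iteratedFDeriv ℝ i M (fun k => X k ω + t k)‖ ≤ Φ ω) {N : ℕ} (hN : 2 * w.card + 2 * α ≤ N)
    (hint : Integrable (fun ω => Φ ω * (1 + ‖fun k => V k ω‖) ^ N *
      ∏ k ∈ w, |anovaRatio (P.map (X k)) (g k) (x k) (X k ω)|) P)
    {L : ℕ} {β C : Fin L → ℝ}
    (hC : ∀ s < α, ∑ ℓ, C ℓ * β ℓ ^ (w.card + 2 * s) = if s = 0 then 1 else 0) :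
    ∃ K : ℝ, ∀ h : Fin d → ℝ, (∀ k, 0 < h k) → (∀ ℓ, |β ℓ| * ‖h‖ ≤ ε) →
      (∀ ℓ, Integrable (fun ω => M (fun k => X k ω + β ℓ * h k * V k ω) *
        ∏ k ∈ w, randomWeight P g X V σ h x ω k) P) ∧
      |∫ ω, mixedPartial w M (fun k => X k ω) *
          ∏ k ∈ w, anovaRatio (P.map (X k)) (g k) (x k) (X k ω) ∂P -
        ∑ ℓ, C ℓ * ∫ ω, M (fun k => X k ω + β ℓ * h k * V k ω) *
          ∏ k ∈ w, randomWeight P g X V σ h x ω k ∂P| ≤ K * ‖h‖ ^ (2 * α) := by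
  obtain ⟨c, hodd, hzero, K, hK⟩ := exists_expansion_integral_mul_prod hX hV hind
    (fun k => measurable_anovaRatio (P.map (X k)) (hg k) (x k)) w (by omega : 0 < 2 * α) hN hM hε
    hdom hint
  let s : ℝ := (σ ^ 2) ^ w.card
  have hs : 0 < s := by positivity
  refine ⟨∑ ℓ, |C ℓ| * (s⁻¹ * |β ℓ| ^ (w.card + 2 * α) * K), fun h hh hsmall => ?_⟩
  have ha : ∀ ℓ k, |β ℓ * h k| ≤ ε := fun ℓ k => by
    rw [abs_mul]
    exact (mul_le_mul_of_nonneg_left (norm_le_pi_norm h k) (abs_nonneg _)).trans (hsmall ℓ)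
  let D : ℝ := ∏ k ∈ w, h k
  have hD : 0 < D := Finset.prod_pos fun k _ => hh k
  let J : Fin L → ℝ := fun ℓ => ∫ ω, M (fun k => X k ω + β ℓ * h k * V k ω) *
    ∏ k ∈ w, (anovaRatio (P.map (X k)) (g k) (x k) (X k ω) * V k ω) ∂P
  have hpull : ∀ ℓ ω, M (fun k => X k ω + β ℓ * h k * V k ω) *
      ∏ k ∈ w, randomWeight P g X V σ h x ω k = (D * s)⁻¹ *
        (M (fun k => X k ω + β ℓ * h k * V k ω) *
          ∏ k ∈ w, (anovaRatio (P.map (X k)) (g k) (x k) (X k ω) * V k ω)) := fun ℓ ω => by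
    rw [prod_randomWeight]
    ring
  simp only [hpull]
  refine ⟨fun ℓ => (hK (fun k => β ℓ * h k) (ha ℓ)).1.const_mul _, ?_⟩
  simp only [integral_const_mul]
  let E : ℕ → ℝ := fun j => ∑ q : Fin j → Fin d, (∏ i, h (q i)) * c j q
  have hE0 : E 0 = s * ∫ ω, mixedPartial w M (fun k => X k ω) *
      ∏ k ∈ w, anovaRatio (P.map (X k)) (g k) (x k) (X k ω) ∂P := by
    simp only [E, Finset.univ_eq_empty, Finset.prod_empty, one_mul, Fintype.sum_unique]
    exact hzero _
  have hexp : ∀ ℓ, |J ℓ - β ℓ ^ w.card * D * ∑ j ∈ Finset.range (2 * α), β ℓ ^ j * E j| ≤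
      |β ℓ| ^ w.card * D * (|β ℓ| * ‖h‖) ^ (2 * α) * K := by
    intro ℓ
    have h1 := (hK (fun k => β ℓ * h k) (ha ℓ)).2
    have h2 : ‖fun k => β ℓ * h k‖ = |β ℓ| * ‖h‖ := by
      rw [← Real.norm_eq_abs, ← norm_smul]
      rfl
    have h3 : ∏ k ∈ w, (β ℓ * h k) = β ℓ ^ w.card * D := by
      rw [Finset.prod_mul_distrib, Finset.prod_const]
    have h4 : ∏ k ∈ w, |β ℓ * h k| = |β ℓ| ^ w.card * D := by
      rw [← Finset.abs_prod, h3, abs_mul, abs_pow, abs_of_pos hD]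
    have h5 : ∀ j, ∑ q : Fin j → Fin d, (∏ i, β ℓ * h (q i)) * c j q = β ℓ ^ j * E j := fun j => by
      rw [Finset.mul_sum]
      refine Finset.sum_congr rfl fun q _ => ?_
      rw [Finset.prod_mul_distrib, Finset.prod_const, Finset.card_univ, Fintype.card_fin, mul_assoc]
    simp only [h2, h3, h4, h5] at h1
    exact h1
  have hmain : ∑ ℓ, C ℓ * (s⁻¹ * (β ℓ ^ w.card * ∑ j ∈ Finset.range (2 * α), β ℓ ^ j * E j)) =
      s⁻¹ * E 0 := by
    have h1 : ∀ j ∈ Finset.range (2 * α), (∑ ℓ, C ℓ * β ℓ ^ (w.card + j)) * E j =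
        if j = 0 then E 0 else 0 := by
      intro j hj
      rcases Nat.even_or_odd' j with ⟨i, rfl | rfl⟩
      · rw [hC i (by have := Finset.mem_range.1 hj; omega)]
        by_cases hi : i = 0
        · simp [hi]
        · simp [hi]
      · have : E (2 * i + 1) = 0 := Finset.sum_eq_zero fun q _ => by
          rw [hodd _ q ⟨i, rfl⟩, mul_zero]
        simp [this]
    calc _ = s⁻¹ * ∑ j ∈ Finset.range (2 * α), (∑ ℓ, C ℓ * β ℓ ^ (w.card + j)) * E j := by
          simp only [Finset.mul_sum, Finset.sum_mul]
          rw [Finset.sum_comm]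
          refine Finset.sum_congr rfl fun j _ => Finset.sum_congr rfl fun ℓ _ => ?_
          rw [pow_add]
          ring
      _ = _ := by
          rw [Finset.sum_congr rfl h1, Finset.sum_ite_eq' _ 0 fun _ => E 0, if_pos]
          exact Finset.mem_range.2 (by omega)
  have hT : ∫ ω, mixedPartial w M (fun k => X k ω) *
      ∏ k ∈ w, anovaRatio (P.map (X k)) (g k) (x k) (X k ω) ∂P = s⁻¹ * E 0 := by
    rw [hE0, ← mul_assoc, inv_mul_cancel₀ hs.ne', one_mul]
  rw [hT, ← hmain, ← Finset.sum_sub_distrib, Finset.sum_mul]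
  refine (Finset.abs_sum_le_sum_abs _ _).trans (Finset.sum_le_sum fun ℓ _ => ?_)
  rw [← mul_sub, abs_mul, mul_assoc]
  refine mul_le_mul_of_nonneg_left ?_ (abs_nonneg _)
  have hfac : s⁻¹ * (β ℓ ^ w.card * ∑ j ∈ Finset.range (2 * α), β ℓ ^ j * E j) -
      (D * s)⁻¹ * J ℓ = -((D * s)⁻¹ *
        (J ℓ - β ℓ ^ w.card * D * ∑ j ∈ Finset.range (2 * α), β ℓ ^ j * E j)) := by
    field_simp
    ring
  change |_ - (D * s)⁻¹ * J ℓ| ≤ _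
  rw [hfac, abs_neg, abs_mul, abs_of_pos (by positivity : 0 < (D * s)⁻¹)]
  calc _ ≤ (D * s)⁻¹ * (|β ℓ| ^ w.card * D * (|β ℓ| * ‖h‖) ^ (2 * α) * K) :=
        mul_le_mul_of_nonneg_left (hexp ℓ) (by positivity)
    _ = _ := by
        have h1 := inv_mul_cancel₀ hD.ne'
        rw [mul_pow, pow_add, mul_inv]
        linear_combination (s⁻¹ * |β ℓ| ^ w.card * |β ℓ| ^ (2 * α) * ‖h‖ ^ (2 * α) * K) * h1

/-- The centred function is the sum over all nonempty sets `w` of the means of `∂_w M` weighted by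
the ratios, grouped by the cardinality of `w`. -/
lemma sub_integral_eq_sum_mixedPartial [IsProbabilityMeasure P] {I : Fin d → Set ℝ}
    (hX : ContinuousInputs P I g X) (hind : iIndepFun X P) {x : Fin d → ℝ} (hx : ∀ j, x j ∈ I j)
    (hM : ContDiff ℝ d M)
    (hint : ∀ w : Finset (Fin d), Integrable (fun ω => mixedPartial w M (fun k => X k ω) *
      ∏ k ∈ w, anovaRatio (P.map (X k)) (g k) (x k) (X k ω)) P) :
    M x - ∫ ω, M (fun k => X k ω) ∂P = ∑ p ∈ Finset.Icc 1 d,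
      ∑ w ∈ Finset.powersetCard p Finset.univ, ∫ ω, mixedPartial w M (fun k => X k ω) *
        ∏ k ∈ w, anovaRatio (P.map (X k)) (g k) (x k) (X k ω) ∂P := by
  have hXm := hX.measurable_input
  have hXm' : Measurable fun ω k => X k ω := measurable_pi_lambda _ hXm
  have hlaw := (iIndepFun_iff_map_fun_eq_pi_map fun i => (hXm i).aemeasurable).1 hind
  have hp : ∀ i, IsProbabilityMeasure (P.map (X i)) := fun i =>
    Measure.isProbabilityMeasure_map (hXm i).aemeasurable
  let r : Fin d → ℝ → ℝ := fun k => anovaRatio (P.map (X k)) (g k) (x k)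
  have hr : ∀ k, Measurable (r k) := fun k => measurable_anovaRatio _ (hX.measurable_density k) _
  have hmeas : ∀ w : Finset (Fin d),
      Measurable fun y : Fin d → ℝ => mixedPartial w M y * ∏ k ∈ w, r k (y k) := by
    intro w
    have hw : w.card ≤ d := by simpa using Finset.card_le_univ w
    have h1 : ContDiff ℝ (0 + w.card : ℕ) M := hM.of_le (by simpa using hw)
    exact (ContDiff.mixedPartial (n := 0) w h1).continuous.measurable.mul
      (Finset.measurable_prod _ fun k _ => (hr k).comp (measurable_pi_apply k))
  obtain ⟨-, h⟩ := integral_piecewise_eq_sum_mixedPartial (fun k => P.map (X k)) (r := r) x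
    (fun k f f' hf hf' hi => eq_integral_add_integral_deriv_mul_anovaRatio
      (hX.ordConnected_interval k) (hX.measurable_density k) (hX.density_nonneg k)
      (hX.density_pos_iff k) (hX.map_input k) (hx k) hf hf' hi)
    Finset.univ ∅ (Finset.disjoint_empty_left _) (F := M) (by simpa using hM)
    (fun w _ => by
      rw [← hlaw]
      simp only [Finset.empty_union]
      exact (integrable_map_measure (hmeas w).aestronglyMeasurable hXm'.aemeasurable).2 (hint w))
  have hint_map : ∀ w : Finset (Fin d), ∫ y, mixedPartial w M y * ∏ k ∈ w, r k (y k)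
      ∂Measure.pi (fun k => P.map (X k)) =
      ∫ ω, mixedPartial w M (fun k => X k ω) * ∏ k ∈ w, r k (X k ω) ∂P := fun w => by
    rw [← hlaw, integral_map hXm'.aemeasurable (hmeas w).aestronglyMeasurable]
  simp only [Finset.empty_union, hint_map, Finset.piecewise_univ, Finset.prod_empty, mul_one,
    integral_const, probReal_univ, one_smul] at h
  rw [h, Finset.sum_powerset, Finset.card_univ, Fintype.card_fin, Finset.range_eq_Ico,
    Finset.sum_eq_sum_Ico_succ_bot (Nat.succ_pos d)]
  simp only [Finset.powersetCard_zero, Finset.sum_singleton, mixedPartial_empty,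
    Finset.prod_empty, mul_one, add_sub_cancel_left]
  rfl
end

theorem mainTheorem1 (d L : ℕ) (hd : 0 < d) (hL : 0 < L) (β : Fin L → ℝ)
    (hβ : Function.Injective β) (hβ0 : ∃ ℓ, β ℓ ≠ 0) :
    ∃ αd : ℕ, 1 ≤ αd ∧ αd ≤ L ∧
      ((∀ ℓ, β ℓ ≠ 0) → Function.Injective (fun ℓ => |β ℓ|) → αd = L) ∧
      ∃ C : Fin L → ℕ → ℝ,
        ∀ (S : Type*) [MeasurableSpace S] (P : Measure S) [IsProbabilityMeasure P]
          (I : Fin d → Set ℝ) (g : Fin d → ℝ → ℝ) (X V : Fin d → S → ℝ) (σ : ℝ)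
          (M : (Fin d → ℝ) → ℝ) (x : Fin d → ℝ) (α : ℕ),
          0 < σ → ContinuousInputs P I g X → Perturbation P σ V →
          iIndepFun (Sum.elim X V) P →
          (∀ j, x j ∈ I j) →
          1 ≤ α → α ≤ αd → SmoothEnough P g X V x (d + 2 * α) M →
          Integrable (fun ω => M (fun k => X k ω)) P ∧
          (∀ᶠ h in 𝓝[{h : Fin d → ℝ | ∀ k, 0 < h k}] 0, ∀ ℓ, ∀ p ∈ Finset.Icc 1 d,
            Integrable (surrogateTerm P g X V σ M h x (β ℓ) p) P) ∧
          (fun h : Fin d → ℝ =>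
              (M x - ∫ ω, M (fun k => X k ω) ∂P) -
                ∑ ℓ, ∑ p ∈ Finset.Icc 1 d,
                  C ℓ p * ∫ ω, surrogateTerm P g X V σ M h x (β ℓ) p ω ∂P)
            =O[𝓝[{h : Fin d → ℝ | ∀ k, 0 < h k}] 0]
              (fun h => ‖WithLp.toLp 2 h‖ ^ (2 * α)) := by
  obtain ⟨αd, h1, h2, h3, C, hC⟩ := exists_moment_coefficients L hL β hβ0
  refine ⟨αd, h1, h2, h3, C, ?_⟩
  intro S _ P _ I g X V σ M x α hσ hX hV hind hx hα hαd hM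
  obtain ⟨ε, hε, Φ, hdom, hint⟩ := hM.dominated
  have hMd := hM.contDiff
  have hXm := hX.measurable_input
  have hXm' : Measurable fun ω k => X k ω := measurable_pi_lambda _ hXm
  have hg := hX.measurable_density
  have hindX : iIndepFun X P := hind.precomp (g := Sum.inl) Sum.inl_injective
  have hcard : ∀ w : Finset (Fin d), w.card ≤ d := fun w => by simpa using Finset.card_le_univ w
  have hdomX : ∀ w : Finset (Fin d), ∀ᵐ ω ∂P, |mixedPartial w M (fun k => X k ω)| ≤ Φ ω := by
    intro w
    filter_upwards [hdom] with ω hω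
    have hw : ContDiff ℝ (0 + w.card : ℕ) M :=
      hMd.of_le (by have := hcard w; exact_mod_cast (by omega : 0 + w.card ≤ d + 2 * α))
    have h4 := norm_iteratedFDeriv_mixedPartial_le w hw (fun k => X k ω)
    rw [norm_iteratedFDeriv_zero] at h4
    refine h4.trans ?_
    simpa using hω 0 (fun k => by simp only [Pi.zero_apply, abs_zero]; positivity) (0 + w.card)
      (by have := hcard w; omega)
  have hρm : ∀ w : Finset (Fin d), Measurable fun ω =>
      ∏ k ∈ w, anovaRatio (P.map (X k)) (g k) (x k) (X k ω) := fun w =>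
    Finset.measurable_prod _ fun k _ => (measurable_anovaRatio _ (hg k) _).comp (hXm k)
  have hintX : ∀ w : Finset (Fin d), Integrable (fun ω => mixedPartial w M (fun k => X k ω) *
      ∏ k ∈ w, anovaRatio (P.map (X k)) (g k) (x k) (X k ω)) P := by
    intro w
    have hw : ContDiff ℝ (0 + w.card : ℕ) M :=
      hMd.of_le (by have := hcard w; exact_mod_cast (by omega : 0 + w.card ≤ d + 2 * α))
    have h5 := integrable_mul_of_dominated (Y := fun _ => 1) (N := d + (d + 2 * α))
      ((ContDiff.mixedPartial (n := 0) w hw).continuous.measurable.comp hXm').aestronglyMeasurable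
      aestronglyMeasurable_const (hρm w).aestronglyMeasurable (hdomX w)
      (fun ω => by
        rw [abs_one]
        exact one_le_pow₀ (by linarith [norm_nonneg fun k => V k ω]))
      (by simpa only [Finset.abs_prod] using hint w)
    simpa using h5
  have hsmall : ∀ᶠ h in 𝓝[{h : Fin d → ℝ | ∀ k, 0 < h k}] 0,
      (∀ k, 0 < h k) ∧ ∀ ℓ, |β ℓ| * ‖h‖ ≤ ε := by
    refine eventually_mem_nhdsWithin.and (eventually_nhdsWithin_of_eventually_nhds ?_)
    refine eventually_all.2 fun ℓ => ?_
    have hc : Tendsto (fun h : Fin d → ℝ => |β ℓ| * ‖h‖) (𝓝 0) (𝓝 (|β ℓ| * ‖(0 : Fin d → ℝ)‖)) :=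
      (continuous_const.mul continuous_norm).tendsto 0
    rw [norm_zero, mul_zero] at hc
    exact (hc.eventually (gt_mem_nhds hε)).mono fun h hh => hh.le
  have hbound := fun w : Finset (Fin d) => exists_surrogate_error_bound (N := d + (d + 2 * α))
    (L := L) (β := β) (C := fun ℓ => C ℓ w.card) hσ hXm hg hV hind x w hα
    (hMd.of_le (by have := hcard w; exact_mod_cast (by omega : 2 * α + w.card ≤ d + 2 * α))) hε
    (hdom.mono fun ω hω t ht i hi => hω t ht i (by have := hcard w; omega))
    (by have := hcard w; omega) (hint w) fun s hs => hC w.card s (hs.trans_le hαd)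
  choose K hK using hbound
  refine ⟨by simpa [mixedPartial_empty] using hintX ∅, ?_, ?_⟩
  · filter_upwards [hsmall] with h hh ℓ p _
    refine (integrable_finsetSum (Finset.powersetCard p Finset.univ)
      fun w _ => (hK w h hh.1 hh.2).1 ℓ).congr
      (Eventually.of_forall fun ω => ?_)
    exact (surrogateTerm_eq_sum h x (β ℓ) p ω).symm
  · refine IsBigO.of_bound (∑ p ∈ Finset.Icc 1 d,
      ∑ w ∈ Finset.powersetCard p (Finset.univ : Finset (Fin d)), |K w|) ?_
    filter_upwards [hsmall] with h hh
    have hnorm : ‖h‖ ≤ ‖WithLp.toLp 2 h‖ :=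
      (pi_norm_le_iff_of_nonneg (norm_nonneg _)).2 fun k => PiLp.norm_apply_le (WithLp.toLp 2 h) k
    have hsum : ∑ ℓ, ∑ p ∈ Finset.Icc 1 d,
        C ℓ p * ∫ ω, surrogateTerm P g X V σ M h x (β ℓ) p ω ∂P =
        ∑ p ∈ Finset.Icc 1 d, ∑ w ∈ Finset.powersetCard p Finset.univ,
          ∑ ℓ, C ℓ w.card * ∫ ω, M (fun k => X k ω + β ℓ * h k * V k ω) *
            ∏ k ∈ w, randomWeight P g X V σ h x ω k ∂P := by
      rw [Finset.sum_comm]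
      refine Finset.sum_congr rfl fun p _ => ?_
      rw [Finset.sum_comm]
      refine Finset.sum_congr rfl fun ℓ _ => ?_
      simp only [surrogateTerm_eq_sum]
      rw [integral_finsetSum _ fun w _ => (hK w h hh.1 hh.2).1 ℓ, Finset.mul_sum]
      refine Finset.sum_congr rfl fun w hw => ?_
      rw [(Finset.mem_powersetCard.1 hw).2]
    rw [sub_integral_eq_sum_mixedPartial hX hindX hx
      (hMd.of_le (by exact_mod_cast Nat.le_add_right _ _)) hintX, hsum, ← Finset.sum_sub_distrib,
      Finset.sum_mul]
    refine (norm_sum_le _ _).trans (Finset.sum_le_sum fun p _ => ?_)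
    rw [← Finset.sum_sub_distrib, Finset.sum_mul]
    refine (norm_sum_le _ _).trans (Finset.sum_le_sum fun w _ => ?_)
    refine ((hK w h hh.1 hh.2).2).trans ?_
    rw [norm_pow, norm_norm]
    exact mul_le_mul (le_abs_self _) (pow_le_pow_left₀ (norm_nonneg _) hnorm _) (by positivity)
      (abs_nonneg _)
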